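/- Let $0<r\le q<s<\infty$ and define $t$ by $1/t=1/q-1/s$. Let $(\Omega,\mu)$ be a $\sigma$-finite measure space with $\mu\neq 0$, and let $L_s(\mu)$ be the space of (classes of) real-valued measurable functions $f$ with $\|f\|_{L_s(\mu)}=(\int|f|^s\,d\mu)^{1/s}<\infty$. Let $Y$ be a real $r$-Banach space, i.e. a real vector space with a functional $\|\cdot\|\ge 0$, vanishing only at $0$, such that $\|ay\|=|a|\,\|y\|$ and $\|x+y\|^r\le\|x\|^r+\|y\|^r$, and complete for the metric $\|x-y\|^r$. Let $T:L_s(\mu)\to Y$ be a bounded linear operator. For a finite measure $\nu$ on $\Omega$, $0<p,q'<\infty$ and measurable $f$, put $$\|f\|_{L_{p,q'}(\nu)}=\left(\int_0^\infty \frac{q'}{p}\,\tau^{q'/p-1}f^*(\tau)^{q'}\,d\tau\right)^{1/q'},\qquad f^*(\tau)=\inf_{\nu(E)\le \tau}\ \sup_{\omega\notin E}|f(\omega)|,$$ the infimum being over measurable sets $E$. Then the following conditions are equivalent: (i) There is a constant $C_1$ such that for all $n$ and all $f_1,\dots,f_n\in L_s(\mu)$ that are pairwise disjoint (for $i\ne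 j$, $f_if_j=0$ $\mu$-a.e.), $$\Big(\sum_{i=1}^n\|Tf_i\|^q\Big)^{1/q}\le C_1\Big\|\sum_{i=1}^n|f_i|\Big\|_{L_s(\mu)}.$$ (ii) There are a constant $C_2$ and a probability measure $\lambda$ on $\Omega$ such that for all $f\in L_s(\mu)$ and all measurable $E\subset\Omega$, $$\|T(f\chi_E)\|\le C_2\|f\|_{L_s(\mu)}\,\lambda(E)^{1/q-1/s}.$$ (iii) There are a constant $C_3$ and a probability measure $\lambda$ on $\Omega$ such that for all $f\in L_s(\mu)$ and all measurable $g:\Omega\to\mathbb R$ with $|g|\le 1$, $$\|T(fg)\|\le C_3\|f\|_{L_s(\mu)}\,\|g\|_{L_{t,r}(\lambda)}.$$ (iv) There are a constant $C_4$ and $w\in L_1(\mu)$ with $w\ge 0$ and $\int w\,d\mu=1$ such that for all $f\in L_s(\mu)$, $$\|Tf\|\le C_4\,\|f\,w^{-1/s}\|_{L_{q,r}(w\mu)}$$ (the value of $fw^{-1/s}$ on the $w\mu$-null set $\{w=0\}$ is irrelevant). -/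

import Mathlib

open MeasureTheory Filter Topology
open scoped ENNReal NNReal

/-- An `r`-Banach space over `ℝ`: `‖·‖` is a quasi-norm whose `r`-th power is subadditive, and
the space is complete for the associated metric `‖x - y‖ ^ r` (equivalently, every sequence that
is Cauchy for `‖·‖` converges for `‖·‖`). -/
class RBanachSpace (r : ℝ) (Y : Type*) [AddCommGroup Y] [Module ℝ Y] [Norm Y] : Prop where
  norm_nonneg : ∀ y : Y, 0 ≤ ‖y‖
  norm_eq_zero_iff : ∀ y : Y, ‖y‖ = 0 ↔ y = 0
  norm_smul : ∀ (a : ℝ) (y : Y), ‖a • y‖ = |a| * ‖y‖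
  norm_add_rpow_le : ∀ x y : Y, ‖x + y‖ ^ r ≤ ‖x‖ ^ r + ‖y‖ ^ r
  complete : ∀ u : ℕ → Y,
    (∀ ε : ℝ, 0 < ε → ∃ N : ℕ, ∀ m ≥ N, ∀ n ≥ N, ‖u m - u n‖ < ε) →
      ∃ y : Y, Tendsto (fun n => ‖u n - y‖) atTop (𝓝 0)

/-- The decreasing rearrangement `f*(t) = inf_{ν(E) ≤ t} sup_{x ∉ E} |f(x)|`. -/
noncomputable def decreasingRearrangement {Ω : Type*} [MeasurableSpace Ω] (ν : Measure Ω)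
    (f : Ω → ℝ) (t : ℝ) : ℝ≥0∞ :=
  ⨅ (E : Set Ω) (_ : MeasurableSet E) (_ : ν E ≤ ENNReal.ofReal t),
    ⨆ (x : Ω) (_ : x ∉ E), ENNReal.ofReal |f x|

/-- The Lorentz functional
`‖f‖_{L_{p,q}(ν)} = (∫₀^∞ (q/p) t^{q/p-1} f*(t)^q dt)^{1/q}`, with values in `[0,∞]`. -/
noncomputable def lorentzNorm {Ω : Type*} [MeasurableSpace Ω] (p q : ℝ) (ν : Measure Ω)
    (f : Ω → ℝ) : ℝ≥0∞ :=
  (∫⁻ t in Set.Ioi (0 : ℝ),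
    ENNReal.ofReal (q / p * t ^ (q / p - 1)) * decreasingRearrangement ν f t ^ q) ^ (1 / q)

/-- The product of an element of `L_s` with a measurable function bounded by one is in `L_s`. -/
theorem memLp_mul_of_abs_le_one {Ω : Type*} [MeasurableSpace Ω] {μ : Measure Ω} {p : ℝ≥0∞}
    (f : Lp ℝ p μ) {g : Ω → ℝ} (hg : Measurable g) (hg1 : ∀ x, |g x| ≤ 1) :
    MemLp (fun x => f x * g x) p μ := by
  refine (Lp.memLp f).of_le ((Lp.aestronglyMeasurable f).mul hg.aestronglyMeasurable)
    (Eventually.of_forall fun x => ?_)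
  rw [norm_mul]
  exact mul_le_of_le_one_right (norm_nonneg _) (by simpa using hg1 x)

/-! All conditions are compared with (ii), domination on sets with exponent 1/q - 1/s = 1/t. Let
N(E) be the norm of T on functions supported in E (`localNorm`). Condition (ii) says that N^t is
bounded by a multiple of a probability measure.

(i) ⇒ (ii). Testing (i) on suitably scaled disjoint functions gives ∑ N(E_i)^t ≤ (2C)^t for disjoint
E_i (`sum_localNorm_rpow_le`). The set function φ = N^r is subadditive, and N^t = φ^P with P = t/r ≥
1, because r ≤ q ≤ t. The main point is that for such φ a bound on disjoint families implies, up to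
the factor 4^(P+1), the same bound for fractional packings ∑ c_i 1_{A_i} ≤ 1
(`IsPackingValue.le_of_finite`). The proof is probabilistic: draw members of a nearly optimal
packing independently, with probabilities proportional to c_i, and keep from each only what lies
outside its predecessors. As long as each point is covered with small probability, Minkowski's
inequality shows that a fixed fraction of the value survives each draw. By convex duality (the M.
Riesz extension theorem) the packing bound is a finitely additive probability dominating φ^P. The
Fatou property of N lets domination survive the passage to a countably additive measure
(`exists_probabilityMeasure_ge`).

(ii) ⇒ (i) is Hölder's inequality with exponents s/q and t/q, applied to essentially disjoint
supports.

(ii) ⇒ (iii), (iv). Cut the function at the dyadic levels of g, respectively of f w^(-1/s), apply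
(ii) on each level, and add r-th powers; the dyadic sum is controlled by the Lorentz functional with
second index r (`norm_map_le_lorentzNorm`). For (iv) the dominating measure is first replaced by one
with a strictly positive density.

(iii) ⇒ (ii) takes g to be an indicator. (iv) ⇒ (ii) combines Chebyshev's inequality in L_s(wμ) with
the small support of f χ_E (`lorentzNorm_mul_rpow_le`). -/

/-! ### Fractional packings versus disjoint families -/

/-- Minkowski's inequality for finite weighted sums. -/
theorem weighted_Lp_add_le {ι : Type*} [Fintype ι] {P : ℝ} (hP : 1 ≤ P) {w f g : ι → ℝ}
    (hw : ∀ i, 0 ≤ w i) (hf : ∀ i, 0 ≤ f i) (hg : ∀ i, 0 ≤ g i) :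
    (∑ i, w i * (f i + g i) ^ P) ^ (1 / P)
      ≤ (∑ i, w i * f i ^ P) ^ (1 / P) + (∑ i, w i * g i ^ P) ^ (1 / P) := by
  have hP0 : P ≠ 0 := by positivity
  have key : ∀ h : ι → ℝ, (∀ i, 0 ≤ h i) → ∀ i, (w i ^ (1 / P) * h i) ^ P = w i * h i ^ P := by
    intro h hh i
    rw [Real.mul_rpow (Real.rpow_nonneg (hw i) _) (hh i), ← Real.rpow_mul (hw i),
      one_div_mul_cancel hP0, Real.rpow_one]
  have := Real.Lp_add_le_of_nonneg (Finset.univ : Finset ι) hP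
    (f := fun i => w i ^ (1 / P) * f i) (g := fun i => w i ^ (1 / P) * g i)
    (fun i _ => mul_nonneg (Real.rpow_nonneg (hw i) _) (hf i))
    (fun i _ => mul_nonneg (Real.rpow_nonneg (hw i) _) (hg i))
  simp only [← mul_add, key f hf, key g hg,
    key (fun i => f i + g i) (fun i => add_nonneg (hf i) (hg i))] at this
  exact this

/-- If `S ^ (1/P) ≤ x ^ (1/P) + y ^ (1/P)` and `y` is small, then `x` is comparable to `S`. -/
theorem le_of_rpow_le_add_of_small {P S x y : ℝ} (hP : 1 ≤ P) (hS : 0 ≤ S) (hx : 0 ≤ x)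
    (hy : 0 ≤ y) (h : S ^ (1 / P) ≤ x ^ (1 / P) + y ^ (1 / P)) (hyS : y ≤ (2 : ℝ) ^ (-P) * S) :
    (2 : ℝ) ^ (-P) * S ≤ x := by
  have hP0 : 0 < P := by positivity
  have e : ((2 : ℝ) ^ (-P) * S) ^ (1 / P) = 2⁻¹ * S ^ (1 / P) := by
    rw [Real.mul_rpow (by positivity) hS, ← Real.rpow_mul (by norm_num)]
    have : -P * (1 / P) = -1 := by field_simp
    rw [this, Real.rpow_neg_one]
  have h1 : y ^ (1 / P) ≤ 2⁻¹ * S ^ (1 / P) := by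
    rw [← e]; exact Real.rpow_le_rpow hy hyS (by positivity)
  have h2 : ((2 : ℝ) ^ (-P) * S) ^ (1 / P) ≤ x ^ (1 / P) := by rw [e]; linarith
  exact (Real.rpow_le_rpow_iff (by positivity) hx (by positivity)).1 h2

/-- `g` is the sum of `φ ^ P` over a finite disjoint family of subsets of `U`. -/
def IsDisjointSum {α : Type*} (φ : Set α → ℝ) (P : ℝ) (U : Set α) (g : ℝ) : Prop :=
  ∃ (n : ℕ) (E : Fin n → Set α), (∀ i j, i ≠ j → Disjoint (E i) (E j)) ∧ (∀ i, E i ⊆ U) ∧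
    g = ∑ i, φ (E i) ^ P

theorem IsDisjointSum.zero {α : Type*} (φ : Set α → ℝ) (P : ℝ) (U : Set α) :
    IsDisjointSum φ P U 0 :=
  ⟨0, fun i => i.elim0, fun i => i.elim0, fun i => i.elim0, by simp⟩

/-- One greedy step: only the part of A not yet covered is added, so the family stays disjoint while
the covered region grows to U ∪ A. -/
theorem IsDisjointSum.union_sdiff {α : Type*} {φ : Set α → ℝ} {P : ℝ} {U : Set α} {g : ℝ}
    (h : IsDisjointSum φ P U g) (A : Set α) :
    IsDisjointSum φ P (U ∪ A) (g + φ (A \ U) ^ P) := by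
  obtain ⟨n, E, hE, hEU, rfl⟩ := h
  refine ⟨n + 1, Fin.cons (A \ U) E, ?_, ?_, ?_⟩
  · intro i j
    refine Fin.cases ?_ (fun i => ?_) i <;> refine Fin.cases ?_ (fun j => ?_) j
    · simp
    · intro _
      simpa using (Set.disjoint_sdiff_left).mono_right (hEU j)
    · intro _
      simpa using (Set.disjoint_sdiff_right).mono_left (hEU i)
    · intro hij
      simpa using hE i j (by simpa using hij)
  · intro i
    refine Fin.cases ?_ (fun i => ?_) i
    · simpa using Set.sdiff_subset.trans Set.subset_union_right
    · simpa using (hEU i).trans Set.subset_union_left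
  · rw [Fin.sum_univ_succ]
    simp [add_comm]

/-- `V` is the value of a fractional packing for `φ ^ P`: a finite weighted family of sets whose
weights at every point add up to at most `M`. -/
def IsPackingValue {α : Type*} (φ : Set α → ℝ) (P M V : ℝ) : Prop :=
  ∃ (ι : Type) (_ : Fintype ι) (c : ι → ℝ) (A : ι → Set α), (∀ i, 0 ≤ c i) ∧
    (∀ x, ∑ i, c i * (A i).indicator 1 x ≤ M) ∧ V = ∑ i, c i * φ (A i) ^ P

theorem IsPackingValue.scale {α : Type*} {φ : Set α → ℝ} {P M V : ℝ}
    (h : IsPackingValue φ P M V) {a : ℝ} (ha : 0 ≤ a) : IsPackingValue φ P (a * M) (a * V) := by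
  obtain ⟨ι, _, c, A, hc, hA, rfl⟩ := h
  refine ⟨ι, inferInstance, fun i => a * c i, A, fun i => mul_nonneg ha (hc i), fun x => ?_, ?_⟩
  · simpa only [mul_assoc, ← Finset.mul_sum] using mul_le_mul_of_nonneg_left (hA x) ha
  · simp only [mul_assoc, ← Finset.mul_sum]

/-- A crude count whose only role is to make the supremum of packing values finite; the dependence
on the cardinality disappears later. -/
theorem IsPackingValue.le_card {α : Type*} [Fintype α] {φ : Set α → ℝ} {P B V : ℝ}
    (hφ0 : ∀ S, 0 ≤ φ S) (hempty : φ ∅ = 0) (hP : 0 < P) (hB : ∀ S, φ S ^ P ≤ B)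
    (h : IsPackingValue φ P 1 V) : V ≤ Fintype.card α * B := by
  obtain ⟨ι, _, c, A, hc, hA, rfl⟩ := h
  have hB0 : 0 ≤ B := (Real.rpow_nonneg (hφ0 ∅) P).trans (hB ∅)
  calc ∑ i, c i * φ (A i) ^ P
      ≤ ∑ i, ∑ x, c i * (A i).indicator 1 x * B := by
        refine Finset.sum_le_sum fun i _ => ?_
        rw [← Finset.sum_mul, ← Finset.mul_sum, mul_assoc]
        refine mul_le_mul_of_nonneg_left ?_ (hc i)
        rcases (A i).eq_empty_or_nonempty with h0 | ⟨x, hx⟩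
        · simp [h0, hempty, Real.zero_rpow hP.ne']
        · have : (1 : ℝ) ≤ ∑ x, (A i).indicator 1 x := by
            calc (1 : ℝ) = (A i).indicator 1 x := by simp [hx]
              _ ≤ _ := Finset.single_le_sum (f := fun x => (A i).indicator (1 : α → ℝ) x)
                (fun y _ => Set.indicator_nonneg (fun _ _ => zero_le_one) y) (Finset.mem_univ x)
          nlinarith [hB (A i)]
    _ = ∑ x, (∑ i, c i * (A i).indicator 1 x) * B := by
        rw [Finset.sum_comm]; simp only [Finset.sum_mul]
    _ ≤ ∑ _x : α, 1 * B := Finset.sum_le_sum fun x _ => mul_le_mul_of_nonneg_right (hA x) hB0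
    _ = Fintype.card α * B := by simp

/-- A random set `U` covering each point with probability at most `u ≤ δ`, independent of a random
member `A i` of a nearly optimal packing, leaves most of the value of `A i` outside `U`. -/
theorem packing_gain {α β ι : Type} [Fintype β] [Fintype ι] {φ : Set α → ℝ} {P K δ S : ℝ}
    (hP : 1 ≤ P) (hφ0 : ∀ S, 0 ≤ φ S)
    (hsub : ∀ A B, Disjoint A B → φ (A ∪ B) ≤ φ A + φ B) (hδ : 0 < δ)
    (hK : ∀ V, IsPackingValue φ P 1 V → V ≤ K)
    {c : ι → ℝ} {A : ι → Set α} (hc : ∀ i, 0 ≤ c i) (hA : ∀ x, ∑ i, c i * (A i).indicator 1 x ≤ 1)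
    (hS : S = ∑ i, c i * φ (A i) ^ P) (hKS : δ * K ≤ 2 ^ (-P) * S)
    {w : β → ℝ} {U : β → Set α} (hw : ∀ b, 0 ≤ w b) (hw1 : ∑ b, w b = 1)
    (hU : ∀ x, ∑ b, w b * (U b).indicator 1 x ≤ δ) :
    2 ^ (-P) * S ≤ ∑ p : β × ι, w p.1 * c p.2 * φ (A p.2 \ U p.1) ^ P := by
  have hwc : ∀ p : β × ι, 0 ≤ w p.1 * c p.2 := fun p => mul_nonneg (hw _) (hc _)
  have hS0 : 0 ≤ S := by
    rw [hS]; exact Finset.sum_nonneg fun i _ => mul_nonneg (hc i) (Real.rpow_nonneg (hφ0 _) _)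
  -- Y is the value lost inside the random set. By independence the sets A i ∩ U b form a packing of
  -- total weight at most δ, so Y ≤ δ K, which is too small to absorb S in Minkowski's inequality.
  set Y : ℝ := ∑ p : β × ι, w p.1 * c p.2 * φ (A p.2 ∩ U p.1) ^ P with hY
  have hYK : Y ≤ δ * K := by
    have hpack : IsPackingValue φ P δ Y := by
      refine ⟨β × ι, inferInstance, fun p => w p.1 * c p.2, fun p => A p.2 ∩ U p.1, hwc,
        fun x => ?_, rfl⟩
      have : ∀ p : β × ι, w p.1 * c p.2 * (A p.2 ∩ U p.1).indicator 1 x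
          = (w p.1 * (U p.1).indicator 1 x) * (c p.2 * (A p.2).indicator 1 x) := by
        intro p
        rw [Set.inter_indicator_one]; simp only [Pi.mul_apply]; ring
      simp only [this]
      rw [Fintype.sum_prod_type]
      simp only [← Finset.mul_sum]
      rw [← Finset.sum_mul]
      have h0 : 0 ≤ ∑ b, w b * (U b).indicator 1 x := Finset.sum_nonneg fun b _ =>
        mul_nonneg (hw b) (Set.indicator_nonneg (fun _ _ => zero_le_one) x)
      calc _ ≤ (∑ b, w b * (U b).indicator 1 x) * 1 := mul_le_mul_of_nonneg_left (hA x) h0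
        _ ≤ δ := by simpa using hU x
    have h1 := hpack.scale (inv_nonneg.2 hδ.le)
    rw [inv_mul_cancel₀ hδ.ne'] at h1
    have h2 := hK _ h1
    rwa [inv_mul_le_iff₀ hδ] at h2
  refine le_of_rpow_le_add_of_small (y := Y) hP hS0 ?_ ?_ ?_ (hYK.trans hKS)
  · exact Finset.sum_nonneg fun p _ => mul_nonneg (hwc p) (Real.rpow_nonneg (hφ0 _) _)
  · exact Finset.sum_nonneg fun p _ => mul_nonneg (hwc p) (Real.rpow_nonneg (hφ0 _) _)
  · refine le_trans ?_ (weighted_Lp_add_le hP hwc (fun p => hφ0 (A p.2 \ U p.1))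
      (fun p => hφ0 (A p.2 ∩ U p.1)))
    refine Real.rpow_le_rpow hS0 ?_ (by positivity)
    have : S = ∑ p : β × ι, w p.1 * c p.2 * φ (A p.2) ^ P := by
      rw [Fintype.sum_prod_type]
      simp only [mul_assoc, ← Finset.mul_sum]
      rw [← Finset.sum_mul, hw1, one_mul, hS]
    rw [this]
    refine Finset.sum_le_sum fun p _ => mul_le_mul_of_nonneg_left ?_ (hwc p)
    refine Real.rpow_le_rpow (hφ0 _) ?_ (by positivity)
    have h3 := hsub (A p.2 \ U p.1) (A p.2 ∩ U p.1)
      (Set.disjoint_sdiff_left.mono_right Set.inter_subset_right)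
    rwa [Set.sdiff_union_inter] at h3

/-- Fractional packings on a finite set are controlled by disjoint families. -/
theorem IsPackingValue.le_of_finite {α : Type} [Finite α] {φ : Set α → ℝ} {P B V : ℝ}
    (hP : 1 ≤ P) (hφ0 : ∀ S, 0 ≤ φ S) (hempty : φ ∅ = 0)
    (hsub : ∀ A B, Disjoint A B → φ (A ∪ B) ≤ φ A + φ B)
    (hdisj : ∀ g, IsDisjointSum φ P Set.univ g → g ≤ B)
    (h : IsPackingValue φ P 1 V) : V ≤ 4 ^ (P + 1) * B := by
  have := Fintype.ofFinite α
  have hB : ∀ S, φ S ^ P ≤ B := by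
    intro S
    have := hdisj _ ((IsDisjointSum.zero φ P ∅).union_sdiff S |>.imp fun n ⟨E, h1, _, h3⟩ =>
      ⟨E, h1, fun i => Set.subset_univ _, h3⟩)
    simpa using this
  have hB0 : 0 ≤ B := hdisj 0 (IsDisjointSum.zero _ _ _)
  -- This value gives δ K ≤ 2 ^ (-P) * S as soon as S ≥ K / 2, and 1 / δ ^ 2 is the constant 4 ^ (P
  -- + 1).
  set δ : ℝ := 2 ^ (-P) / 2 with hδ
  have hδ0 : 0 < δ := by positivity
  have h4 : (4 : ℝ) ^ (P + 1) = 1 / δ ^ 2 := by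
    rw [hδ, div_pow, ← Real.rpow_natCast _ 2, ← Real.rpow_mul (by norm_num),
      Real.rpow_add (by norm_num), show (4 : ℝ) = 2 ^ (2 : ℝ) by norm_num, ← Real.rpow_mul (by norm_num)]
    rw [show -P * ((2 : ℕ) : ℝ) = -(2 * P) by push_cast; ring, Real.rpow_neg (by norm_num)]
    norm_num
    ring
  have hbdd : BddAbove {V | IsPackingValue φ P 1 V} :=
    ⟨_, fun V hV => hV.le_card hφ0 hempty (by positivity) hB⟩
  set K : ℝ := sSup {V | IsPackingValue φ P 1 V} with hKdef
  have hK : ∀ V, IsPackingValue φ P 1 V → V ≤ K := fun V hV => le_csSup hbdd hV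
  refine (hK V h).trans ?_
  by_contra! hcon
  have hKpos : 0 < K := lt_of_le_of_lt (by positivity) hcon
  obtain ⟨S, ⟨ι, _, c, A, hc, hA, hS⟩, hSK⟩ :=
    exists_lt_of_lt_csSup ⟨V, h⟩ (half_lt_self hKpos)
  set W : ℝ := ∑ i, c i with hW
  have hWpos : 0 < W := by
    refine (Finset.sum_nonneg fun i _ => hc i).lt_of_ne fun h0 => ?_
    have h1 := (Finset.sum_eq_zero_iff_of_nonneg fun i _ => hc i).1 h0.symm
    have : S = 0 := by rw [hS]; exact Finset.sum_eq_zero fun i hi => by rw [h1 i hi, zero_mul]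
    linarith
  have hKS : δ * K ≤ 2 ^ (-P) * S := by
    have : (0 : ℝ) < 2 ^ (-P) := by positivity
    rw [hδ]; nlinarith
  -- State after j independent draws of i with probability c i / W: each point is covered with
  -- probability at most j / W, and the expected disjoint sum is at least j times the gain δ K / W.
  -- The draw after the j-th needs j / W ≤ δ, hence the shift by one, which permits ⌈δ W⌉ draws and
  -- a total gain of at least δ ^ 2 * K.
  have claim : ∀ j : ℕ, (j : ℝ) - 1 ≤ δ * W → ∃ (β : Type) (_ : Fintype β) (w : β → ℝ)
      (U : β → Set α) (g : β → ℝ), (∀ b, 0 ≤ w b) ∧ ∑ b, w b = 1 ∧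
      (∀ x, ∑ b, w b * (U b).indicator 1 x ≤ j / W) ∧ (∀ b, IsDisjointSum φ P (U b) (g b)) ∧
      j * (δ * K / W) ≤ ∑ b, w b * g b := by
    intro j
    induction j with
    | zero =>
      intro _
      exact ⟨Unit, inferInstance, fun _ => 1, fun _ => ∅, fun _ => 0, by simp, by simp, by simp,
        fun _ => IsDisjointSum.zero _ _ _, by simp⟩
    | succ j ih =>
      intro hj
      push_cast at hj
      obtain ⟨β, _, w, U, g, hw, hw1, hU, hg, hgain⟩ := ih (by linarith)
      have hstep := packing_gain hP hφ0 hsub hδ0 hK hc hA hS hKS hw hw1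
        (fun x => (hU x).trans ((div_le_iff₀ hWpos).2 (by linarith)))
      refine ⟨β × ι, inferInstance, fun p => w p.1 * c p.2 / W, fun p => U p.1 ∪ A p.2,
        fun p => g p.1 + φ (A p.2 \ U p.1) ^ P, fun p => ?_, ?_, fun x => ?_,
        fun p => (hg p.1).union_sdiff _, ?_⟩
      · exact div_nonneg (mul_nonneg (hw _) (hc _)) hWpos.le
      · rw [← Finset.sum_div, Fintype.sum_prod_type]
        simp only [← Finset.mul_sum]
        rw [← Finset.sum_mul, hw1, one_mul, div_self hWpos.ne']
      · calc ∑ p : β × ι, w p.1 * c p.2 / W * (U p.1 ∪ A p.2).indicator 1 x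
            ≤ ∑ p : β × ι, (w p.1 * (U p.1).indicator 1 x * (c p.2 / W)
                + w p.1 * (c p.2 * (A p.2).indicator 1 x / W)) := by
              refine Finset.sum_le_sum fun p _ => ?_
              have hnn : 0 ≤ w p.1 * c p.2 / W := div_nonneg (mul_nonneg (hw _) (hc _)) hWpos.le
              have : (U p.1 ∪ A p.2).indicator (1 : α → ℝ) x
                  ≤ (U p.1).indicator 1 x + (A p.2).indicator 1 x := by
                by_cases h1 : x ∈ U p.1 <;> by_cases h2 : x ∈ A p.2 <;> simp [h1, h2]
              calc _ ≤ _ := mul_le_mul_of_nonneg_left this hnn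
                _ = _ := by ring
          _ = (∑ b, w b * (U b).indicator 1 x) + (∑ i, c i * (A i).indicator 1 x) / W := by
              rw [Finset.sum_add_distrib, Fintype.sum_prod_type, Fintype.sum_prod_type]
              simp only [← Finset.mul_sum, ← Finset.sum_mul, ← Finset.sum_div]
              rw [hw1, one_mul, ← hW, div_self hWpos.ne', mul_one]
          _ ≤ j / W + 1 / W := add_le_add (hU x) (div_le_div_of_nonneg_right (hA x) hWpos.le)
          _ = ((j + 1 : ℕ) : ℝ) / W := by push_cast; ring
      · have e : ∑ p : β × ι, w p.1 * c p.2 / W * (g p.1 + φ (A p.2 \ U p.1) ^ P)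
            = (∑ b, w b * g b)
              + (∑ p : β × ι, w p.1 * c p.2 * φ (A p.2 \ U p.1) ^ P) / W := by
          have : ∀ p : β × ι, w p.1 * c p.2 / W * (g p.1 + φ (A p.2 \ U p.1) ^ P)
              = w p.1 * g p.1 * (c p.2 / W) + w p.1 * c p.2 * φ (A p.2 \ U p.1) ^ P / W :=
            fun p => by ring
          simp only [this]
          rw [Finset.sum_add_distrib, ← Finset.sum_div, Fintype.sum_prod_type]
          simp only [← Finset.mul_sum, ← Finset.sum_mul, ← Finset.sum_div]
          rw [← hW, div_self hWpos.ne', mul_one]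
        rw [e]
        have h5 : δ * K / W ≤ (∑ p : β × ι, w p.1 * c p.2 * φ (A p.2 \ U p.1) ^ P) / W :=
          div_le_div_of_nonneg_right (hKS.trans hstep) hWpos.le
        push_cast
        linarith
  obtain ⟨β, _, w, U, g, hw, hw1, -, hg, hgain⟩ := claim ⌈δ * W⌉₊
    (by linarith [Nat.ceil_lt_add_one (show 0 ≤ δ * W by positivity)])
  have hgB : ∑ b, w b * g b ≤ B := by
    calc ∑ b, w b * g b ≤ ∑ b, w b * B := Finset.sum_le_sum fun b _ =>
          mul_le_mul_of_nonneg_left (hdisj _ ((hg b).imp fun n ⟨E, h1, _, h3⟩ =>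
            ⟨E, h1, fun i => Set.subset_univ _, h3⟩)) (hw b)
      _ = B := by rw [← Finset.sum_mul, hw1, one_mul]
  have h6 : δ * W * (δ * K / W) ≤ B :=
    (mul_le_mul_of_nonneg_right (Nat.le_ceil _) (by positivity)).trans (hgain.trans hgB)
  have h7 : δ * W * (δ * K / W) = δ ^ 2 * K := by field_simp
  rw [h4, one_div, inv_mul_lt_iff₀ (by positivity)] at hcon
  linarith

/-! ### From packing bounds to a dominating probability measure -/

/-- Fractional packings by measurable sets are controlled by disjoint families. -/
theorem measurable_packing_le {Ω : Type*} [MeasurableSpace Ω] {φ : Set Ω → ℝ} {P B M : ℝ}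
    (hP : 1 ≤ P) (hφ0 : ∀ S, 0 ≤ φ S) (hempty : φ ∅ = 0)
    (hsub : ∀ A B, MeasurableSet A → MeasurableSet B → Disjoint A B → φ (A ∪ B) ≤ φ A + φ B)
    (hdisj : ∀ (n : ℕ) (E : Fin n → Set Ω), (∀ i, MeasurableSet (E i)) →
      (∀ i j, i ≠ j → Disjoint (E i) (E j)) → ∑ i, φ (E i) ^ P ≤ B)
    {ι : Type} [Fintype ι] {c : ι → ℝ} {A : ι → Set Ω} (hc : ∀ i, 0 ≤ c i)
    (hAm : ∀ i, MeasurableSet (A i)) (hM : 0 ≤ M)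
    (hA : ∀ x, ∑ i, c i * (A i).indicator 1 x ≤ M) :
    ∑ i, c i * φ (A i) ^ P ≤ 4 ^ (P + 1) * B * M := by
  have hB0 : 0 ≤ B := by simpa using hdisj 0 (fun i => i.elim0) (fun i => i.elim0) fun i => i.elim0
  -- M may be 0, whereas the rescaling to total weight 1 divides by the bound.
  suffices h : ∀ M' : ℝ, M < M' → ∑ i, c i * φ (A i) ^ P ≤ 4 ^ (P + 1) * B * M' by
    refine ge_of_tendsto (f := fun M' => 4 ^ (P + 1) * B * M') (x := 𝓝[>] M) ?_
      (eventually_nhdsWithin_of_forall h)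
    exact (tendsto_nhdsWithin_of_tendsto_nhds (Continuous.tendsto (by fun_prop) M))
  intro M' hMM
  have hM' : 0 < M' := hM.trans_lt hMM
  -- Only the finite algebra generated by the A i matters, so points are replaced by their
  -- membership patterns.
  let pat : Ω → Set ι := fun x => {i | x ∈ A i}
  have hpat : ∀ S : Set (Set ι), MeasurableSet (pat ⁻¹' S) := by
    have : Measurable pat := measurable_set_iff.2 fun i => (hAm i).mem
    exact fun S => this (Set.toFinite S).measurableSet
  let ψ : Set (Set ι) → ℝ := fun S => φ (pat ⁻¹' S)
  -- Patterns realized by no point may violate the weight bound; they are removed, which does not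
  -- change the preimages.
  let A' : ι → Set (Set ι) := fun i => {σ | i ∈ σ ∧ ∑ j, c j * σ.indicator 1 j ≤ M'}
  have hA' : ∀ i, pat ⁻¹' (A' i) = A i := by
    intro i
    ext x
    have : ∑ j, c j * (pat x).indicator 1 j ≤ M' := (hA x).trans hMM.le
    simp [A', this]
    simp [pat]
  have hpack : IsPackingValue ψ P M' (∑ i, c i * φ (A i) ^ P) := by
    refine ⟨ι, inferInstance, c, A', hc, fun σ => ?_, by simp [ψ, hA']⟩
    by_cases hσ : ∑ j, c j * σ.indicator 1 j ≤ M'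
    · refine le_trans (Finset.sum_le_sum fun j _ => mul_le_mul_of_nonneg_left ?_ (hc j)) hσ
      by_cases hj : j ∈ σ <;> simp [A', hj, hσ]
    · simp [A', hσ, hM'.le]
  have h1 := hpack.scale (inv_nonneg.2 hM'.le)
  rw [inv_mul_cancel₀ hM'.ne'] at h1
  have h2 := h1.le_of_finite (φ := ψ) (B := B) hP (fun S => hφ0 _) (by simpa [ψ] using hempty)
    (fun S T hST => hsub _ _ (hpat S) (hpat T) (hST.preimage pat))
    (by
      rintro g ⟨n, E, hE, -, rfl⟩
      exact hdisj n _ (fun i => hpat (E i)) fun i j hij => (hE i j hij).preimage pat)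
  rw [inv_mul_le_iff₀ hM'] at h2
  linarith

/-- A finitely additive probability dominating `φ ^ P` up to a constant. -/
theorem exists_positive_functional_ge {Ω : Type*} [MeasurableSpace Ω] [Nonempty Ω]
    {φ : Set Ω → ℝ} {P B : ℝ} (hB : 0 < B)
    (hP : 1 ≤ P) (hφ0 : ∀ S, 0 ≤ φ S) (hempty : φ ∅ = 0)
    (hsub : ∀ A B, MeasurableSet A → MeasurableSet B → Disjoint A B → φ (A ∪ B) ≤ φ A + φ B)
    (hdisj : ∀ (n : ℕ) (E : Fin n → Set Ω), (∀ i, MeasurableSet (E i)) →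
      (∀ i j, i ≠ j → Disjoint (E i) (E j)) → ∑ i, φ (E i) ^ P ≤ B) :
    ∃ L : SimpleFunc Ω ℝ →ₗ[ℝ] ℝ, (∀ h : SimpleFunc Ω ℝ, (∀ x, 0 ≤ h x) → 0 ≤ L h) ∧ L 1 = 1 ∧
      ∀ E, MeasurableSet E →
        φ E ^ P ≤ 4 ^ (P + 1) * B * L ((1 : SimpleFunc Ω ℝ).restrict E) := by
  set K : ℝ := 4 ^ (P + 1) * B with hKdef
  have hK : 0 < K := by positivity
  -- The cone generated by the nonnegative functions and the functions 1_A - φ(A)^P / K. A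
  -- functional nonnegative on it with value 1 at the constant 1 is what is sought. The packing
  -- bound says exactly that a constant in this cone is nonnegative, which is the hypothesis for
  -- extending from constants.
  let S : PointedCone ℝ (SimpleFunc Ω ℝ) :=
    { carrier := {h | ∃ (ι : Type) (_ : Fintype ι) (c : ι → ℝ) (A : ι → Set Ω), (∀ i, 0 ≤ c i) ∧
        (∀ i, MeasurableSet (A i)) ∧
        ∀ x, ∑ i, c i * ((A i).indicator 1 x - φ (A i) ^ P / K) ≤ h x}
      zero_mem' := ⟨Empty, inferInstance, fun i => i.elim, fun i => i.elim, fun i => i.elim,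
        fun i => i.elim, fun x => by simp⟩
      add_mem' := by
        rintro h₁ h₂ ⟨ι, _, c, A, hc, hA, h⟩ ⟨κ, _, d, D, hd, hD, h'⟩
        refine ⟨ι ⊕ κ, inferInstance, Sum.elim c d, Sum.elim A D, ?_, ?_, fun x => ?_⟩
        · rintro (i | i)
          exacts [hc i, hd i]
        · rintro (i | i)
          exacts [hA i, hD i]
        · rw [Fintype.sum_sum_type]
          exact add_le_add (h x) (h' x)
      smul_mem' := by
        rintro a h ⟨ι, _, c, A, hc, hA, h'⟩
        refine ⟨ι, inferInstance, fun i => a * c i, A, fun i => mul_nonneg a.2 (hc i), hA,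
          fun x => ?_⟩
        change _ ≤ (a : ℝ) * h x
        simpa only [mul_assoc, ← Finset.mul_sum] using mul_le_mul_of_nonneg_left (h' x) a.2 }
  have hone : (1 : SimpleFunc Ω ℝ) ≠ 0 := fun h => by
    obtain ⟨x⟩ := ‹Nonempty Ω›
    simpa using congrArg (fun g : SimpleFunc Ω ℝ => g x) h
  have hSpos : ∀ h : SimpleFunc Ω ℝ, (∀ x, 0 ≤ h x) → h ∈ S := fun h hh =>
    ⟨Empty, inferInstance, fun i => i.elim, fun i => i.elim, fun i => i.elim,
      fun i => i.elim, fun x => by simpa using hh x⟩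
  let f : SimpleFunc Ω ℝ →ₗ.[ℝ] ℝ := LinearPMap.mkSpanSingleton (1 : SimpleFunc Ω ℝ) (1 : ℝ)
    hone
  obtain ⟨L, hLf, hLS⟩ := riesz_extension S f (by
    rintro ⟨x, hx⟩ hxS
    obtain ⟨a, rfl⟩ := Submodule.mem_span_singleton.1 hx
    have hfa : f ⟨a • 1, hx⟩ = a := by
      have := LinearPMap.mkSpanSingleton'_apply (1 : SimpleFunc Ω ℝ) (1 : ℝ)
        (fun (c : ℝ) hc => by rw [(smul_eq_zero.1 hc).resolve_right hone]; simp) a hx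
      exact this.trans (mul_one a)
    rw [hfa]
    obtain ⟨ι, _, c, A, hc, hA, h⟩ := hxS
    set V : ℝ := ∑ i, c i * φ (A i) ^ P with hV
    have hcov : ∀ x, ∑ i, c i * (A i).indicator 1 x ≤ a + V / K := by
      intro x
      have h1 := h x
      simp only [mul_sub, Finset.sum_sub_distrib, mul_div_assoc', ← Finset.sum_div] at h1
      rw [← hV] at h1
      simp at h1
      simpa using by linarith
    obtain ⟨x₀⟩ := ‹Nonempty Ω›
    have hM : 0 ≤ a + V / K := le_trans (Finset.sum_nonneg fun i _ =>
      mul_nonneg (hc i) (Set.indicator_nonneg (fun _ _ => zero_le_one) x₀)) (hcov x₀)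
    have h2 := measurable_packing_le hP hφ0 hempty hsub hdisj hc hA hM hcov
    rw [← hKdef, ← hV, mul_add, mul_div_cancel₀ _ hK.ne'] at h2
    have : 0 ≤ K * a := by linarith
    exact nonneg_of_mul_nonneg_right this hK) (by
    intro y
    obtain ⟨C, hC⟩ := y.exists_forall_norm_le
    refine ⟨⟨C • 1, Submodule.mem_span_singleton.2 ⟨C, rfl⟩⟩, hSpos _ fun x => ?_⟩
    have := abs_le.1 (hC x)
    simp
    linarith)
  have hL1 : L 1 = 1 := by
    have h1 := hLf ⟨1, Submodule.mem_span_singleton_self 1⟩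
    rw [h1]
    exact LinearPMap.mkSpanSingleton_apply ℝ ℝ hone (1 : ℝ)
  refine ⟨L, fun h hh => hLS h (hSpos h hh), hL1, fun E hE => ?_⟩
  have h1 := hLS ((1 : SimpleFunc Ω ℝ).restrict E - (φ E ^ P / K) • 1)
    ⟨Unit, inferInstance, fun _ => 1, fun _ => E, fun _ => zero_le_one, fun _ => hE, fun x => by
      simp [SimpleFunc.restrict_apply _ hE]⟩
  rw [map_sub, map_smul, hL1] at h1
  simp at h1
  rwa [div_le_iff₀' hK] at h1

/-- **Domination of a set function by a probability measure.** A set function `φ` that is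
subadditive on disjoint sets and satisfies `∑ φ (E i) ^ P ≤ B` for disjoint families, as well as a
Fatou property, satisfies `φ E ^ P ≤ K * lam E` for some probability measure `lam`. -/
theorem exists_probabilityMeasure_ge {Ω : Type*} [MeasurableSpace Ω] [Nonempty Ω]
    {φ : Set Ω → ℝ} {P B : ℝ} (hB : 0 < B)
    (hP : 1 ≤ P) (hφ0 : ∀ S, 0 ≤ φ S) (hempty : φ ∅ = 0)
    (hsub : ∀ A B, MeasurableSet A → MeasurableSet B → Disjoint A B → φ (A ∪ B) ≤ φ A + φ B)
    (hdisj : ∀ (n : ℕ) (E : Fin n → Set Ω), (∀ i, MeasurableSet (E i)) →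
      (∀ i j, i ≠ j → Disjoint (E i) (E j)) → ∑ i, φ (E i) ^ P ≤ B)
    (hfatou : ∀ (E : Set Ω) (F : ℕ → Set Ω), MeasurableSet E → (∀ n, MeasurableSet (F n)) →
      Monotone F → E ⊆ ⋃ n, F n → ∀ c : ℝ, (∀ n, φ (F n) ≤ c) → φ E ≤ c) :
    ∃ lam : Measure Ω, IsProbabilityMeasure lam ∧ ∀ E, MeasurableSet E →
      φ E ^ P ≤ 4 ^ (P + 1) * B * lam.real E := by
  obtain ⟨L, hLpos, hL1, hLφ⟩ := exists_positive_functional_ge hB hP hφ0 hempty hsub hdisj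
  set K : ℝ := 4 ^ (P + 1) * B with hKdef
  have hK : 0 < K := by positivity
  have hP0 : 0 < P := by positivity
  set l : Set Ω → ℝ := fun E => L ((1 : SimpleFunc Ω ℝ).restrict E) with hl
  have hl0 : ∀ E, MeasurableSet E → 0 ≤ l E := fun E hE => hLpos _ fun x => by
    rw [SimpleFunc.restrict_apply _ hE]; exact Set.indicator_nonneg (fun _ _ => zero_le_one) x
  have hlempty : l ∅ = 0 := by simp [hl]
  have hluniv : l Set.univ = 1 := by simp [hl, hL1]
  have hladd : ∀ A B, MeasurableSet A → MeasurableSet B → l (A ∩ B) + l (A \ B) = l A := by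
    intro A B hA hB
    rw [hl, ← map_add]
    congr 1
    ext x
    rw [SimpleFunc.coe_add, Pi.add_apply, SimpleFunc.restrict_apply _ hA,
      SimpleFunc.restrict_apply _ (hA.inter hB), SimpleFunc.restrict_apply _ (hA.diff hB)]
    by_cases h1 : x ∈ A <;> by_cases h2 : x ∈ B <;> simp [h1, h2]
  have hlunion : ∀ A B, MeasurableSet A → MeasurableSet B → l (A ∪ B) ≤ l A + l B := by
    intro A B hA hB
    have h1 := hladd (A ∪ B) A (hA.union hB) hA
    have h2 := hladd B A hB hA
    rw [Set.union_inter_cancel_left, Set.union_sdiff_left] at h1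
    have := hl0 _ (hB.inter hA)
    linarith
  classical
  -- The value ⊤ leaves only measurable covers relevant. The induced measure can be strictly smaller
  -- than the finitely additive l, so domination of φ has to be proved anew.
  let m : Set Ω → ℝ≥0∞ := fun E => if MeasurableSet E then ENNReal.ofReal (l E) else ⊤
  have hm0 : m ∅ = 0 := by simp [m, hlempty]
  let O := OuterMeasure.ofFunction m hm0
  have hO : ‹MeasurableSpace Ω› ≤ O.caratheodory := by
    intro s hs
    refine OuterMeasure.ofFunction_caratheodory fun u => ?_
    by_cases hu : MeasurableSet u
    · simp only [m, hu, hu.inter hs, hu.diff hs, if_true]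
      rw [← ENNReal.ofReal_add (hl0 _ (hu.inter hs)) (hl0 _ (hu.diff hs)), hladd u s hu hs]
    · simp [m, hu]
  let ν := O.toMeasure hO
  have hνuniv : ν Set.univ ≤ 1 := by
    rw [toMeasure_apply _ _ MeasurableSet.univ]
    refine (OuterMeasure.ofFunction_le _).trans ?_
    simp [m, hluniv]
  have hdom : ∀ E, MeasurableSet E → ENNReal.ofReal (φ E ^ P / K) ≤ ν E := by
    intro E hE
    rw [toMeasure_apply _ _ hE]
    change _ ≤ OuterMeasure.ofFunction m hm0 E
    rw [OuterMeasure.ofFunction_apply]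
    refine le_iInf₂ fun u hu => ?_
    by_cases hum : ∀ n, MeasurableSet (u n)
    swap
    · obtain ⟨n, hn⟩ := not_forall.1 hum
      have : m (u n) = ⊤ := by simp [m, hn]
      exact le_top.trans (this ▸ ENNReal.le_tsum n)
    by_cases htop : ∑' n, m (u n) = ⊤
    · rw [htop]; exact le_top
    have hFm : ∀ n, MeasurableSet (Set.accumulate u n) := fun n => by
      rw [Set.accumulate_def]
      exact MeasurableSet.biUnion (Set.to_countable _) fun i _ => hum i
    have hF : ∀ n, ENNReal.ofReal (l (Set.accumulate u n)) ≤ ∑ i ∈ Finset.range (n + 1), m (u i) := by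
      intro n
      induction n with
      | zero => simp [m, hum 0]
      | succ n ih =>
        rw [Set.accumulate_succ, Finset.sum_range_succ]
        refine (ENNReal.ofReal_le_ofReal (hlunion _ _ (hFm n) (hum _))).trans ?_
        refine ENNReal.ofReal_add_le.trans (add_le_add ih ?_)
        simp [m, hum (n + 1)]
    set c : ℝ := (∑' n, m (u n)).toReal with hc
    have hc0 : 0 ≤ c := ENNReal.toReal_nonneg
    -- Finite unions need only finite subadditivity of l; `hfatou` then carries the bound to E,
    -- which the whole cover contains.
    have hFc : ∀ n, φ (Set.accumulate u n) ≤ (K * c) ^ (1 / P) := by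
      intro n
      have h1 : l (Set.accumulate u n) ≤ c := by
        rw [hc, ← ENNReal.ofReal_le_iff_le_toReal htop]
        exact (hF n).trans (ENNReal.sum_le_tsum _)
      have h2 : φ (Set.accumulate u n) ^ P ≤ K * c :=
        (hLφ _ (hFm n)).trans (mul_le_mul_of_nonneg_left h1 hK.le)
      rw [one_div]
      exact (Real.le_rpow_inv_iff_of_pos (hφ0 _) (by positivity) hP0).2 h2
    have h3 := hfatou E (Set.accumulate u) hE hFm Set.monotone_accumulate
      (by rwa [Set.iUnion_accumulate]) _ hFc
    rw [one_div, Real.le_rpow_inv_iff_of_pos (hφ0 _) (by positivity) hP0] at h3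
    rw [ENNReal.ofReal_le_iff_le_toReal htop, div_le_iff₀' hK]
    exact h3
  obtain ⟨x₀⟩ := ‹Nonempty Ω›
  -- The total mass of ν may be below 1; the deficit goes into a point mass, which preserves
  -- domination.
  have hprob : IsProbabilityMeasure (ν + (1 - ν Set.univ) • Measure.dirac x₀) :=
    ⟨by simp [add_tsub_cancel_of_le hνuniv]⟩
  refine ⟨_, hprob, fun E hE => ?_⟩
  rw [← div_le_iff₀' hK, Measure.real, ← ENNReal.ofReal_le_iff_le_toReal (measure_ne_top _ _)]
  refine (hdom E hE).trans ?_
  simp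

/-! ### Sums in Y and restrictions in L_s -/

/-- Finite sums in an `r`-Banach space. -/
theorem RBanachSpace.norm_sum_rpow_le {r : ℝ} {Y : Type*} [AddCommGroup Y] [Module ℝ Y] [Norm Y]
    [RBanachSpace r Y] (hr : 0 < r) {ι : Type*} (s : Finset ι) (y : ι → Y) :
    ‖∑ i ∈ s, y i‖ ^ r ≤ ∑ i ∈ s, ‖y i‖ ^ r := by
  classical
  induction s using Finset.induction_on with
  | empty => simp [(RBanachSpace.norm_eq_zero_iff r (0 : Y)).2 rfl, Real.zero_rpow hr.ne']
  | insert a s ha ih =>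
    rw [Finset.sum_insert ha, Finset.sum_insert ha]
    exact (RBanachSpace.norm_add_rpow_le _ _).trans (add_le_add le_rfl ih)

section LpLemmas

variable {Ω : Type*} [MeasurableSpace Ω] {μ : Measure Ω}

theorem Lp_norm_nonneg {p : ℝ≥0∞} (f : Lp ℝ p μ) : 0 ≤ ‖f‖ := ENNReal.toReal_nonneg

/-- The restriction of an element of `L_p` to a measurable set. -/
noncomputable def indicatorLp {p : ℝ≥0∞} (f : Lp ℝ p μ) {E : Set Ω} (hE : MeasurableSet E) :
    Lp ℝ p μ :=
  ((Lp.memLp f).indicator hE).toLp (E.indicator f)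

theorem coeFn_indicatorLp {p : ℝ≥0∞} (f : Lp ℝ p μ) {E : Set Ω} (hE : MeasurableSet E) :
    indicatorLp f hE =ᵐ[μ] E.indicator f :=
  MemLp.coeFn_toLp _

theorem norm_indicatorLp_le {p : ℝ≥0∞} (f : Lp ℝ p μ) {E : Set Ω} (hE : MeasurableSet E) :
    ‖indicatorLp f hE‖ ≤ ‖f‖ := by
  refine Lp.norm_le_norm_of_ae_le ?_
  filter_upwards [coeFn_indicatorLp f hE] with x hx
  rw [hx]
  exact norm_indicator_le_norm_self _ _

theorem norm_sub_indicatorLp_le {p : ℝ≥0∞} (f : Lp ℝ p μ) {E : Set Ω} (hE : MeasurableSet E) :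
    ‖f - indicatorLp f hE‖ ≤ ‖f‖ := by
  refine Lp.norm_le_norm_of_ae_le ?_
  filter_upwards [coeFn_indicatorLp f hE, Lp.coeFn_sub f (indicatorLp f hE)] with x hx hx'
  rw [hx', Pi.sub_apply, hx]
  by_cases h : x ∈ E <;> simp [h]

theorem indicatorLp_eq_self {p : ℝ≥0∞} {f : Lp ℝ p μ} {E : Set Ω} (hE : MeasurableSet E)
    (h : ∀ᵐ x ∂μ, x ∉ E → f x = 0) : indicatorLp f hE = f := by
  refine Lp.ext ?_
  filter_upwards [coeFn_indicatorLp f hE, h] with x hx hx'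
  rw [hx]
  by_cases hxE : x ∈ E
  · simp [hxE]
  · simp [hxE, hx' hxE]

theorem ofReal_norm_rpow {s : ℝ} (hs : 0 < s) (f : Lp ℝ (ENNReal.ofReal s) μ) :
    ENNReal.ofReal ‖f‖ ^ s = ∫⁻ x, ENNReal.ofReal |f x| ^ s ∂μ := by
  have h1 : ENNReal.ofReal ‖f‖ = eLpNorm f (ENNReal.ofReal s) μ := by
    rw [Lp.norm_def, ENNReal.ofReal_toReal (Lp.eLpNorm_ne_top f)]
  rw [h1, eLpNorm_eq_lintegral_rpow_enorm_toReal (by simpa using hs) ENNReal.ofReal_ne_top,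
    ENNReal.toReal_ofReal hs.le, one_div, ENNReal.rpow_inv_rpow hs.ne']
  simp only [← ofReal_norm, Real.norm_eq_abs]

theorem measurable_ofReal_abs_rpow {p : ℝ≥0∞} (f : Lp ℝ p μ) (s : ℝ) :
    Measurable fun x => ENNReal.ofReal |f x| ^ s :=
  (Lp.stronglyMeasurable f).measurable.abs.ennreal_ofReal.pow_const s

/-- Since s may be less than 1, homogeneity is read off the integral formula rather than from a
normed space structure. -/
theorem norm_smul_Lp {s : ℝ} (hs : 0 < s) (a : ℝ) (f : Lp ℝ (ENNReal.ofReal s) μ) :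
    ‖a • f‖ = |a| * ‖f‖ := by
  have h : ENNReal.ofReal ‖a • f‖ ^ s = ENNReal.ofReal (|a| * ‖f‖) ^ s := by
    rw [ENNReal.ofReal_mul (abs_nonneg a), ENNReal.mul_rpow_of_nonneg _ _ hs.le,
      ofReal_norm_rpow hs, ofReal_norm_rpow hs, ← lintegral_const_mul _
        (measurable_ofReal_abs_rpow f s)]
    refine lintegral_congr_ae ?_
    filter_upwards [Lp.coeFn_smul a f] with x hx
    rw [hx, Pi.smul_apply, smul_eq_mul, abs_mul, ENNReal.ofReal_mul (abs_nonneg a),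
      ENNReal.mul_rpow_of_nonneg _ _ hs.le]
  have h2 := ENNReal.rpow_left_injective hs.ne' h
  exact (ENNReal.ofReal_eq_ofReal_iff (Lp_norm_nonneg _)
    (mul_nonneg (abs_nonneg a) (Lp_norm_nonneg _))).1 h2

/-- The `L_s` norm of a sum of disjoint functions. -/
theorem norm_sum_abs_rpow {s : ℝ} (hs : 0 < s) {n : ℕ} (f : Fin n → Lp ℝ (ENNReal.ofReal s) μ)
    (hf : ∀ i j, i ≠ j → ∀ᵐ x ∂μ, f i x = 0 ∨ f j x = 0) :
    ‖∑ i, |f i|‖ ^ s = ∑ i, ‖f i‖ ^ s := by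
  have h : ENNReal.ofReal (‖∑ i, |f i|‖ ^ s) = ENNReal.ofReal (∑ i, ‖f i‖ ^ s) := by
    rw [ENNReal.ofReal_sum_of_nonneg fun i _ => Real.rpow_nonneg (Lp_norm_nonneg _) _]
    simp only [← ENNReal.ofReal_rpow_of_nonneg (Lp_norm_nonneg _) hs.le, ofReal_norm_rpow hs]
    rw [← lintegral_finsetSum _ fun i _ => measurable_ofReal_abs_rpow (f i) s]
    refine lintegral_congr_ae ?_
    have h1 : ∀ᵐ x ∂μ, ∀ i, (|f i| : Lp ℝ (ENNReal.ofReal s) μ) x = |f i x| :=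
      ae_all_iff.2 fun i => Lp.coeFn_abs (f i)
    have h2 : ∀ᵐ x ∂μ, ∀ i j, i ≠ j → f i x = 0 ∨ f j x = 0 := by
      simp only [ae_all_iff]
      exact hf
    filter_upwards [h1, h2, Lp.coeFn_finsetSum Finset.univ fun i => |f i|] with x hx1 hx2 hx3
    rw [hx3, Finset.sum_apply]
    simp only [hx1]
    rw [abs_of_nonneg (Finset.sum_nonneg fun i _ => abs_nonneg _)]
    by_cases hex : ∃ j, f j x ≠ 0
    · obtain ⟨j, hj⟩ := hex
      have h0 : ∀ i, i ≠ j → f i x = 0 := fun i hij => (hx2 i j hij).resolve_right hj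
      rw [Finset.sum_eq_single j (fun i _ hij => by rw [h0 i hij, abs_zero]) (by simp),
        Finset.sum_eq_single j (fun i _ hij => by simp [h0 i hij, hs]) (by simp)]
    · push Not at hex
      simp [hex, hs]
  exact (ENNReal.ofReal_eq_ofReal_iff (Real.rpow_nonneg (Lp_norm_nonneg _) _)
    (Finset.sum_nonneg fun i _ => Real.rpow_nonneg (Lp_norm_nonneg _) _)).1 h

/-- Dominated convergence for restrictions to sets exhausting the support. -/
theorem tendsto_norm_sub_indicatorLp {s : ℝ} (hs : 0 < s) (f : Lp ℝ (ENNReal.ofReal s) μ)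
    {F : ℕ → Set Ω} (hF : ∀ n, MeasurableSet (F n))
    (h : ∀ᵐ x ∂μ, f x ≠ 0 → ∀ᶠ n in atTop, x ∈ F n) :
    Tendsto (fun n => ‖f - indicatorLp f (hF n)‖) atTop (𝓝 0) := by
  have hae : ∀ n, ∀ᵐ x ∂μ, (f - indicatorLp f (hF n)) x = f x - (F n).indicator f x := by
    intro n
    filter_upwards [coeFn_indicatorLp f (hF n), Lp.coeFn_sub f (indicatorLp f (hF n))] with x h1 h2
    rw [h2, Pi.sub_apply, h1]
  have hlim : Tendsto (fun n => ∫⁻ x, ENNReal.ofReal |(f - indicatorLp f (hF n)) x| ^ s ∂μ) atTop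
      (𝓝 (∫⁻ _, 0 ∂μ)) := by
    refine tendsto_lintegral_of_dominated_convergence (fun x => ENNReal.ofReal |f x| ^ s)
      (fun n => measurable_ofReal_abs_rpow _ s) (fun n => ?_) ?_ ?_
    · filter_upwards [hae n] with x hx
      rw [hx]
      refine ENNReal.rpow_le_rpow (ENNReal.ofReal_le_ofReal ?_) hs.le
      by_cases hxF : x ∈ F n <;> simp [hxF]
    · rw [← ofReal_norm_rpow hs]
      exact ENNReal.rpow_ne_top_of_nonneg hs.le ENNReal.ofReal_ne_top
    · filter_upwards [ae_all_iff.2 hae, h] with x hx hx'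
      refine tendsto_const_nhds.congr' ?_
      by_cases h0 : f x = 0
      · refine Eventually.of_forall fun n => ?_
        simp only [hx]
        by_cases hxF : x ∈ F n <;> simp [hxF, h0, hs]
      · filter_upwards [hx' h0] with n hn
        simp only [hx]
        simp [hn, hs]
  simp only [lintegral_zero, ← ofReal_norm_rpow hs] at hlim
  have h2 := (ENNReal.continuous_rpow_const (y := 1 / s)).tendsto 0 |>.comp hlim
  have h3 := (ENNReal.tendsto_toReal (by simp [hs])).comp h2
  convert! h3 using 1
  · ext n
    simp only [Function.comp, one_div, ENNReal.rpow_rpow_inv hs.ne',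
      ENNReal.toReal_ofReal (Lp_norm_nonneg _)]
  · simp [hs]

end LpLemmas

/-! ### The local norm of T as a set function -/

section Operators

variable {Ω : Type*} [MeasurableSpace Ω] {μ : Measure Ω}
  {Y : Type*} [AddCommGroup Y] [Module ℝ Y] [Norm Y]

/-- A bound for `T` passes to limits. -/
theorem rpow_norm_map_le_of_tendsto {r : ℝ} [RBanachSpace r Y] {p : ℝ≥0∞} (hr : 0 < r) (T : Lp ℝ p μ →ₗ[ℝ] Y) {M : ℝ}
    (hM : ∀ f, ‖T f‖ ≤ M * ‖f‖) {f : Lp ℝ p μ} {g : ℕ → Lp ℝ p μ}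
    (hg : Tendsto (fun n => ‖f - g n‖) atTop (𝓝 0)) {c : ℝ} (hc : ∀ n, ‖T (g n)‖ ^ r ≤ c) :
    ‖T f‖ ^ r ≤ c := by
  have h1 : ∀ n, ‖T f‖ ^ r ≤ (M * ‖f - g n‖) ^ r + c := by
    intro n
    have h2 := RBanachSpace.norm_add_rpow_le (r := r) (T (f - g n)) (T (g n))
    rw [← map_add, sub_add_cancel] at h2
    exact h2.trans (add_le_add (Real.rpow_le_rpow (RBanachSpace.norm_nonneg r _) (hM _) hr.le)
      (hc n))
  have h3 : Tendsto (fun n => (M * ‖f - g n‖) ^ r + c) atTop (𝓝 ((M * 0) ^ r + c)) :=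
    ((hg.const_mul M).rpow_const (Or.inr hr.le)).add_const c
  have h4 := ge_of_tendsto' h3 h1
  simpa [Real.zero_rpow hr.ne'] using h4

/-- The norm of `T` on the functions supported in `E`. -/
noncomputable def localNorm {p : ℝ≥0∞} (T : Lp ℝ p μ →ₗ[ℝ] Y) (E : Set Ω) : ℝ :=
  sSup {a | ∃ g : Lp ℝ p μ, ‖g‖ ≤ 1 ∧ (∀ᵐ x ∂μ, x ∉ E → g x = 0) ∧ a = ‖T g‖}

theorem norm_map_zero (r : ℝ) [RBanachSpace r Y] {p : ℝ≥0∞} (T : Lp ℝ p μ →ₗ[ℝ] Y) : ‖T 0‖ = 0 := by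
  rw [map_zero, (RBanachSpace.norm_eq_zero_iff r (0 : Y)).2 rfl]

theorem norm_map_le_localNorm {p : ℝ≥0∞} {T : Lp ℝ p μ →ₗ[ℝ] Y} {M : ℝ}
    (hM : ∀ f, ‖T f‖ ≤ M * ‖f‖) {E : Set Ω} {g : Lp ℝ p μ} (hg : ‖g‖ ≤ 1)
    (hgE : ∀ᵐ x ∂μ, x ∉ E → g x = 0) : ‖T g‖ ≤ localNorm T E := by
  refine le_csSup ⟨|M|, ?_⟩ ⟨g, hg, hgE, rfl⟩
  rintro _ ⟨g, hg, -, rfl⟩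
  calc ‖T g‖ ≤ M * ‖g‖ := hM g
    _ ≤ |M| * ‖g‖ := mul_le_mul_of_nonneg_right (le_abs_self M) (Lp_norm_nonneg g)
    _ ≤ |M| := mul_le_of_le_one_right (abs_nonneg M) hg

theorem localNorm_nonneg (r : ℝ) [RBanachSpace r Y] {p : ℝ≥0∞} (T : Lp ℝ p μ →ₗ[ℝ] Y) (E : Set Ω) : 0 ≤ localNorm T E := by
  refine Real.sSup_nonneg ?_
  rintro _ ⟨g, -, -, rfl⟩
  exact RBanachSpace.norm_nonneg r _
end Operators

section LocalNorm

variable {Ω : Type*} [MeasurableSpace Ω] {μ : Measure Ω}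
  {Y : Type*} [AddCommGroup Y] [Module ℝ Y] [Norm Y]

theorem localNorm_empty (r : ℝ) [RBanachSpace r Y] {p : ℝ≥0∞} (T : Lp ℝ p μ →ₗ[ℝ] Y) :
    localNorm T ∅ = 0 := by
  refine le_antisymm (Real.sSup_nonpos ?_) (localNorm_nonneg r T ∅)
  rintro _ ⟨g, -, hg, rfl⟩
  have : g = 0 := by
    refine Lp.ext ?_
    filter_upwards [hg, Lp.coeFn_zero ℝ p μ] with x hx h0
    rw [h0, Pi.zero_apply, hx (Set.notMem_empty x)]
  rw [this, norm_map_zero r]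

/-- Bounds for `T` on all functions supported in `E` bound the local norm. -/
theorem localNorm_rpow_le {r : ℝ} [RBanachSpace r Y] (hr : 0 < r) {p : ℝ≥0∞}
    {T : Lp ℝ p μ →ₗ[ℝ] Y} {E : Set Ω} {c : ℝ}
    (h : ∀ g : Lp ℝ p μ, ‖g‖ ≤ 1 → (∀ᵐ x ∂μ, x ∉ E → g x = 0) → ‖T g‖ ^ r ≤ c) :
    localNorm T E ^ r ≤ c := by
  have hc : 0 ≤ c := by
    refine le_trans ?_ (h 0 (by simp) ?_)
    · rw [norm_map_zero r, Real.zero_rpow hr.ne']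
    · filter_upwards [Lp.coeFn_zero ℝ p μ] with x h0 _
      rw [h0, Pi.zero_apply]
  have : localNorm T E ≤ c ^ r⁻¹ := by
    refine Real.sSup_le ?_ (Real.rpow_nonneg hc _)
    rintro _ ⟨g, hg, hgE, rfl⟩
    rw [Real.le_rpow_inv_iff_of_pos (RBanachSpace.norm_nonneg r _) hc hr]
    exact h g hg hgE
  rwa [Real.le_rpow_inv_iff_of_pos (localNorm_nonneg r T E) hc hr] at this

/-- Split g into its restriction to A and the rest, which lives on B; both pieces stay in the unit
ball. -/
theorem localNorm_union_rpow_le {r : ℝ} [RBanachSpace r Y] (hr : 0 < r) {p : ℝ≥0∞}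
    {T : Lp ℝ p μ →ₗ[ℝ] Y} {M : ℝ} (hM : ∀ f, ‖T f‖ ≤ M * ‖f‖) {A B : Set Ω}
    (hA : MeasurableSet A) :
    localNorm T (A ∪ B) ^ r ≤ localNorm T A ^ r + localNorm T B ^ r := by
  refine localNorm_rpow_le hr fun g hg hgE => ?_
  have h1 := RBanachSpace.norm_add_rpow_le (r := r) (T (indicatorLp g hA)) (T (g - indicatorLp g hA))
  rw [← map_add, add_sub_cancel] at h1
  refine h1.trans (add_le_add ?_ ?_) <;>
    refine Real.rpow_le_rpow (RBanachSpace.norm_nonneg r _) (norm_map_le_localNorm hM ?_ ?_) hr.le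
  · exact (norm_indicatorLp_le g hA).trans hg
  · filter_upwards [coeFn_indicatorLp g hA] with x hx hxA
    rw [hx, Set.indicator_of_notMem hxA]
  · exact (norm_sub_indicatorLp_le g hA).trans hg
  · filter_upwards [coeFn_indicatorLp g hA, hgE, Lp.coeFn_sub g (indicatorLp g hA)]
      with x hx hxE hx' hxB
    rw [hx', Pi.sub_apply, hx]
    by_cases hxA : x ∈ A
    · simp [hxA]
    · simp [hxA, hxE (by simp [hxA, hxB])]

/-- The Fatou property needed for countable additivity: as s is finite, the restrictions of g to F n
converge to g in L_s, and T is bounded. -/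
theorem localNorm_rpow_le_of_monotone {r s : ℝ} [RBanachSpace r Y] (hr : 0 < r) (hs : 0 < s)
    {T : Lp ℝ (ENNReal.ofReal s) μ →ₗ[ℝ] Y} {M : ℝ} (hM : ∀ f, ‖T f‖ ≤ M * ‖f‖) {E : Set Ω}
    {F : ℕ → Set Ω} (hF : ∀ n, MeasurableSet (F n)) (hmono : Monotone F) (hEF : E ⊆ ⋃ n, F n)
    {c : ℝ} (hc : ∀ n, localNorm T (F n) ^ r ≤ c) : localNorm T E ^ r ≤ c := by
  refine localNorm_rpow_le hr fun g hg hgE => ?_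
  have hlim := tendsto_norm_sub_indicatorLp hs g hF (by
    filter_upwards [hgE] with x hx h0
    obtain ⟨n, hn⟩ := Set.mem_iUnion.1 (hEF (by_contra fun h => h0 (hx h)))
    exact eventually_atTop.2 ⟨n, fun m hm => hmono hm hn⟩)
  refine rpow_norm_map_le_of_tendsto hr T hM hlim fun n => le_trans ?_ (hc n)
  refine Real.rpow_le_rpow (RBanachSpace.norm_nonneg r _) (norm_map_le_localNorm hM ?_ ?_) hr.le
  · exact (norm_indicatorLp_le g _).trans hg
  · filter_upwards [coeFn_indicatorLp g (hF n)] with x hx hxF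
    rw [hx, Set.indicator_of_notMem hxF]

theorem exists_half_localNorm_le (r : ℝ) [RBanachSpace r Y] {p : ℝ≥0∞} (T : Lp ℝ p μ →ₗ[ℝ] Y)
    (E : Set Ω) :
    ∃ g : Lp ℝ p μ, ‖g‖ ≤ 1 ∧ (∀ᵐ x ∂μ, x ∉ E → g x = 0) ∧ localNorm T E / 2 ≤ ‖T g‖ := by
  have hzero : ∀ᵐ x ∂μ, x ∉ E → (0 : Lp ℝ p μ) x = 0 := by
    filter_upwards [Lp.coeFn_zero ℝ p μ] with x h0 _
    rw [h0, Pi.zero_apply]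
  rcases (localNorm_nonneg r T E).eq_or_lt with h0 | hpos
  · exact ⟨0, by simp, hzero, by rw [← h0, zero_div]; exact RBanachSpace.norm_nonneg r _⟩
  · obtain ⟨_, ⟨g, hg, hgE, rfl⟩, h⟩ := exists_lt_of_lt_csSup
      (s := {a | ∃ g : Lp ℝ p μ, ‖g‖ ≤ 1 ∧ (∀ᵐ x ∂μ, x ∉ E → g x = 0) ∧ a = ‖T g‖})
      ⟨_, 0, by simp, hzero, rfl⟩ (half_lt_self hpos)
    exact ⟨g, hg, hgE, h.le⟩

/-! ### Disjoint estimates and domination on sets -/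

/-- A disjoint `q`-estimate for `T` on `L_s` gives a `t`-estimate for the values of `T` on disjoint
functions of norm at most one. -/
theorem sum_norm_map_rpow_le {r q s t : ℝ} [RBanachSpace r Y] (hq : 0 < q) (hs : 0 < s)
    (ht0 : 0 < t) (ht : 1 / t = 1 / q - 1 / s) {T : Lp ℝ (ENNReal.ofReal s) μ →ₗ[ℝ] Y} {C : ℝ≥0}
    (hC : ∀ (n : ℕ) (f : Fin n → Lp ℝ (ENNReal.ofReal s) μ),
      (∀ i j, i ≠ j → ∀ᵐ x ∂μ, f i x = 0 ∨ f j x = 0) →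
      (∑ i, ‖T (f i)‖ ^ q) ^ (1 / q) ≤ C * ‖∑ i, |f i|‖)
    {n : ℕ} (g : Fin n → Lp ℝ (ENNReal.ofReal s) μ)
    (hg : ∀ i j, i ≠ j → ∀ᵐ x ∂μ, g i x = 0 ∨ g j x = 0) (hg1 : ∀ i, ‖g i‖ ≤ 1) :
    ∑ i, ‖T (g i)‖ ^ t ≤ (C : ℝ) ^ t := by
  have hT0 : ∀ f, 0 ≤ ‖T f‖ := fun f => RBanachSpace.norm_nonneg r _
  -- The extremal weights for Hölder duality: since (t/s) q + q = t, both sides become powers of the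
  -- same Z, namely Z^(1/q) ≤ C Z^(1/s).
  set a : Fin n → ℝ := fun i => ‖T (g i)‖ ^ (t / s) with ha
  have ha0 : ∀ i, 0 ≤ a i := fun i => Real.rpow_nonneg (hT0 _) _
  set Z : ℝ := ∑ i, ‖T (g i)‖ ^ t with hZ
  have hZ0 : 0 ≤ Z := Finset.sum_nonneg fun i _ => Real.rpow_nonneg (hT0 _) _
  have hdis : ∀ i j, i ≠ j → ∀ᵐ x ∂μ, (a i • g i) x = 0 ∨ (a j • g j) x = 0 := by
    intro i j hij
    filter_upwards [hg i j hij, Lp.coeFn_smul (a i) (g i), Lp.coeFn_smul (a j) (g j)] with x hx h1 h2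
    rw [h1, h2]
    rcases hx with hx | hx <;> simp [hx]
  have h := hC n (fun i => a i • g i) hdis
  have hqt : t / s * q + q = t := by
    field_simp at ht ⊢
    linarith
  have hl : ∑ i, ‖T (a i • g i)‖ ^ q = Z := by
    refine Finset.sum_congr rfl fun i _ => ?_
    rw [map_smul, RBanachSpace.norm_smul r, abs_of_nonneg (ha0 i), Real.mul_rpow (ha0 i) (hT0 _), ha,
      ← Real.rpow_mul (hT0 _), ← Real.rpow_add_of_nonneg (hT0 _) (by positivity) hq.le, hqt]
  have hrhs : ‖∑ i, |a i • g i|‖ ≤ Z ^ (1 / s) := by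
    rw [one_div, Real.le_rpow_inv_iff_of_pos (Lp_norm_nonneg _) hZ0 hs, norm_sum_abs_rpow hs _ hdis]
    refine Finset.sum_le_sum fun i _ => ?_
    rw [norm_smul_Lp hs, abs_of_nonneg (ha0 i), Real.mul_rpow (ha0 i) (Lp_norm_nonneg _), ha,
      ← Real.rpow_mul (hT0 _), div_mul_cancel₀ _ hs.ne']
    exact mul_le_of_le_one_right (Real.rpow_nonneg (hT0 _) _)
      (Real.rpow_le_one (Lp_norm_nonneg _) (hg1 i) hs.le)
  rw [hl] at h
  rcases hZ0.eq_or_lt with h0 | hpos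
  · rw [← h0]; positivity
  · have h1 : Z ^ (1 / q) ≤ C * Z ^ (1 / s) := h.trans (mul_le_mul_of_nonneg_left hrhs C.coe_nonneg)
    have h2 : Z ^ (1 / t) ≤ C := by
      rw [ht, Real.rpow_sub hpos]
      exact (div_le_iff₀ (Real.rpow_pos_of_pos hpos _)).2 h1
    rwa [one_div, Real.rpow_inv_le_iff_of_pos hZ0 C.coe_nonneg ht0] at h2

theorem sum_localNorm_rpow_le {r q s t : ℝ} [RBanachSpace r Y] (hq : 0 < q) (hs : 0 < s)
    (ht0 : 0 < t) (ht : 1 / t = 1 / q - 1 / s) {T : Lp ℝ (ENNReal.ofReal s) μ →ₗ[ℝ] Y} {C : ℝ≥0}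
    (hC : ∀ (n : ℕ) (f : Fin n → Lp ℝ (ENNReal.ofReal s) μ),
      (∀ i j, i ≠ j → ∀ᵐ x ∂μ, f i x = 0 ∨ f j x = 0) →
      (∑ i, ‖T (f i)‖ ^ q) ^ (1 / q) ≤ C * ‖∑ i, |f i|‖)
    {n : ℕ} (E : Fin n → Set Ω) (hE : ∀ i j, i ≠ j → Disjoint (E i) (E j)) :
    ∑ i, localNorm T (E i) ^ t ≤ (2 * C : ℝ) ^ t := by
  choose g hg1 hgE hg using fun i => exists_half_localNorm_le r T (E i)
  have h := sum_norm_map_rpow_le hq hs ht0 ht (r := r) hC g (fun i j hij => by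
    filter_upwards [hgE i, hgE j] with x hi hj
    by_cases hx : x ∈ E i
    · exact Or.inr (hj fun hxj => Set.disjoint_left.1 (hE i j hij) hx hxj)
    · exact Or.inl (hi hx)) hg1
  rw [Real.mul_rpow (by norm_num) C.coe_nonneg]
  refine le_trans ?_ (mul_le_mul_of_nonneg_left h (by positivity))
  rw [Finset.mul_sum]
  refine Finset.sum_le_sum fun i _ => ?_
  rw [← Real.mul_rpow (by norm_num) (RBanachSpace.norm_nonneg r _)]
  exact Real.rpow_le_rpow (localNorm_nonneg r T _) (by linarith [hg i]) ht0.le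

/-- The operator `T` is dominated by the measure `lam` on restrictions to measurable sets. -/
def DominatedOnSets {p : ℝ≥0∞} (T : Lp ℝ p μ →ₗ[ℝ] Y) (e C : ℝ) (lam : Measure Ω) : Prop :=
  ∀ (f : Lp ℝ p μ) (E : Set Ω) (hE : MeasurableSet E),
    ‖T (indicatorLp f hE)‖ ≤ C * ‖f‖ * lam.real E ^ e

theorem exists_dominatedOnSets {r q s t : ℝ} [Nonempty Ω] [RBanachSpace r Y] (hr : 0 < r)
    (hrt : r ≤ t) (hq : 0 < q) (hs : 0 < s) (ht0 : 0 < t) (ht : 1 / t = 1 / q - 1 / s)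
    {T : Lp ℝ (ENNReal.ofReal s) μ →ₗ[ℝ] Y} {M : ℝ} (hM : ∀ f, ‖T f‖ ≤ M * ‖f‖) {C : ℝ≥0}
    (hC : ∀ (n : ℕ) (f : Fin n → Lp ℝ (ENNReal.ofReal s) μ),
      (∀ i j, i ≠ j → ∀ᵐ x ∂μ, f i x = 0 ∨ f j x = 0) →
      (∑ i, ‖T (f i)‖ ^ q) ^ (1 / q) ≤ C * ‖∑ i, |f i|‖) :
    ∃ (C' : ℝ≥0) (lam : Measure Ω), IsProbabilityMeasure lam ∧
      DominatedOnSets T (1 / t) C' lam := by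
  have hpow : ∀ E : Set Ω, (localNorm T E ^ r) ^ (t / r) = localNorm T E ^ t := by
    intro E
    rw [← Real.rpow_mul (localNorm_nonneg r T E), mul_div_cancel₀ _ hr.ne']
  -- The r-th power makes the local norm subadditive, and P = t / r restores the t-th power. The
  -- summand 1 keeps the bound positive when C = 0.
  obtain ⟨lam, hlam, h⟩ := exists_probabilityMeasure_ge (φ := fun E => localNorm T E ^ r)
    (P := t / r) (B := (2 * C : ℝ) ^ t + 1) (by positivity) ((one_le_div hr).2 hrt)
    (fun E => Real.rpow_nonneg (localNorm_nonneg r T E) _)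
    (by simp [localNorm_empty r, hr.ne'])
    (fun A B hA _ _ => localNorm_union_rpow_le hr hM hA)
    (fun n E _ hE => by
      simp only [hpow]
      linarith [sum_localNorm_rpow_le (r := r) hq hs ht0 ht hC E hE])
    (fun E F _ hF hmono hEF c hc => localNorm_rpow_le_of_monotone hr hs hM hF hmono hEF hc)
  simp only [hpow] at h
  set K : ℝ := 4 ^ (t / r + 1) * ((2 * C : ℝ) ^ t + 1) with hK
  have hK0 : 0 ≤ K := by positivity
  refine ⟨⟨K ^ (1 / t), Real.rpow_nonneg hK0 _⟩, lam, hlam, fun f E hE => ?_⟩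
  have hloc : localNorm T E ≤ K ^ (1 / t) * lam.real E ^ (1 / t) := by
    rw [← Real.mul_rpow hK0 measureReal_nonneg, one_div,
      Real.le_rpow_inv_iff_of_pos (localNorm_nonneg r T E) (by positivity) ht0]
    exact h E hE
  rcases (Lp_norm_nonneg f).eq_or_lt with h0 | hpos
  · rw [← h0, mul_zero, zero_mul]
    refine (hM _).trans ?_
    have : ‖indicatorLp f hE‖ = 0 :=
      le_antisymm (h0 ▸ norm_indicatorLp_le f hE) (Lp_norm_nonneg _)
    rw [this, mul_zero]
  · have h1 : ‖T (‖f‖⁻¹ • indicatorLp f hE)‖ ≤ localNorm T E := by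
      refine norm_map_le_localNorm hM ?_ ?_
      · rw [norm_smul_Lp hs, abs_of_pos (inv_pos.2 hpos), inv_mul_le_iff₀ hpos, mul_one]
        exact norm_indicatorLp_le f hE
      · filter_upwards [coeFn_indicatorLp f hE, Lp.coeFn_smul ‖f‖⁻¹ (indicatorLp f hE)]
          with x hx hx' hxE
        rw [hx', Pi.smul_apply, hx, Set.indicator_of_notMem hxE, smul_zero]
    rw [map_smul, RBanachSpace.norm_smul r, abs_of_pos (inv_pos.2 hpos),
      inv_mul_le_iff₀ hpos] at h1
    calc _ ≤ ‖f‖ * localNorm T E := h1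
      _ ≤ ‖f‖ * (K ^ (1 / t) * lam.real E ^ (1 / t)) := mul_le_mul_of_nonneg_left hloc hpos.le
      _ = K ^ (1 / t) * ‖f‖ * lam.real E ^ (1 / t) := by ring

theorem sum_norm_map_le_of_dominatedOnSets {r q s t : ℝ} [RBanachSpace r Y]
    (hq : 0 < q) (hqs : q < s) (ht0 : 0 < t) (ht : 1 / t = 1 / q - 1 / s)
    {T : Lp ℝ (ENNReal.ofReal s) μ →ₗ[ℝ] Y} {C : ℝ≥0} {lam : Measure Ω} [IsProbabilityMeasure lam]
    (hC : DominatedOnSets T (1 / t) C lam) {n : ℕ} (f : Fin n → Lp ℝ (ENNReal.ofReal s) μ)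
    (hf : ∀ i j, i ≠ j → ∀ᵐ x ∂μ, f i x = 0 ∨ f j x = 0) :
    (∑ i, ‖T (f i)‖ ^ q) ^ (1 / q) ≤ C * ‖∑ i, |f i|‖ := by
  have hs : 0 < s := hq.trans hqs
  have hT0 : ∀ f, 0 ≤ ‖T f‖ := fun f => RBanachSpace.norm_nonneg r _
  have hsupp : ∀ i, MeasurableSet {x | f i x ≠ 0} := fun i =>
    (Lp.stronglyMeasurable (f i)).measurable (measurableSet_singleton 0).compl
  -- The supports are disjoint only μ-a.e., and lam may charge μ-null sets; removing the overlaps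
  -- makes the sets truly disjoint without changing f i as a class.
  set E : Fin n → Set Ω := fun i => {x | f i x ≠ 0} \ ⋃ j, ⋃ _ : j ≠ i, {x | f j x ≠ 0} with hE
  have hEm : ∀ i, MeasurableSet (E i) := fun i =>
    (hsupp i).diff (MeasurableSet.iUnion fun j => MeasurableSet.iUnion fun _ => hsupp j)
  have hEdis : Pairwise (Function.onFun Disjoint E) := by
    intro i j hij
    refine Set.disjoint_left.2 fun x hxi hxj => hxj.2 ?_
    exact Set.mem_iUnion₂.2 ⟨i, hij, hxi.1⟩
  have hfE : ∀ i, indicatorLp (f i) (hEm i) = f i := by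
    intro i
    refine indicatorLp_eq_self _ ?_
    have : ∀ᵐ x ∂μ, ∀ j, j ≠ i → f i x = 0 ∨ f j x = 0 := by
      simp only [ae_all_iff]
      exact fun j hj => hf i j hj.symm
    filter_upwards [this] with x hx hxE
    by_contra h0
    refine hxE ⟨h0, fun hmem => ?_⟩
    obtain ⟨j, hj, hjx⟩ := Set.mem_iUnion₂.1 hmem
    exact hjx ((hx j hj).resolve_left h0)
  have hb : ∀ i, ‖T (f i)‖ ≤ C * (‖f i‖ * lam.real (E i) ^ (1 / t)) := by
    intro i
    have := hC (f i) (E i) (hEm i)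
    rwa [hfE, mul_assoc] at this
  have hlam : ∑ i, lam.real (E i) ≤ 1 := by
    rw [← measureReal_iUnion_fintype hEdis hEm]
    exact measureReal_le_one
  have hconj : (s / q).HolderConjugate (t / q) := by
    rw [Real.holderConjugate_iff]
    refine ⟨(one_lt_div hq).2 hqs, ?_⟩
    field_simp at ht ⊢
    linarith
  have hhold := Real.inner_le_Lp_mul_Lq_of_nonneg Finset.univ hconj
    (f := fun i => ‖f i‖ ^ q) (g := fun i => lam.real (E i) ^ (q / t))
    (fun i _ => Real.rpow_nonneg (Lp_norm_nonneg _) _)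
    (fun i _ => Real.rpow_nonneg measureReal_nonneg _)
  have e1 : ∀ i, (‖f i‖ ^ q) ^ (s / q) = ‖f i‖ ^ s := fun i => by
    rw [← Real.rpow_mul (Lp_norm_nonneg _), mul_div_cancel₀ _ hq.ne']
  have e2 : ∀ i, (lam.real (E i) ^ (q / t)) ^ (t / q) = lam.real (E i) := fun i => by
    rw [← Real.rpow_mul measureReal_nonneg, div_mul_div_cancel₀ ht0.ne', div_self hq.ne',
      Real.rpow_one]
  simp only [e1, e2, ← norm_sum_abs_rpow hs f hf] at hhold
  set N := ‖∑ i, |f i|‖ with hN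
  have hN0 : 0 ≤ N := Lp_norm_nonneg _
  have e3 : (N ^ s) ^ (1 / (s / q)) = N ^ q := by
    rw [← Real.rpow_mul hN0]; congr 1; field_simp
  have h1 : (∑ i, lam.real (E i)) ^ (1 / (t / q)) ≤ 1 :=
    Real.rpow_le_one (Finset.sum_nonneg fun i _ => measureReal_nonneg) hlam (by positivity)
  rw [e3] at hhold
  have h2 : ∑ i, ‖T (f i)‖ ^ q ≤ (C * N) ^ q := by
    calc ∑ i, ‖T (f i)‖ ^ q ≤ ∑ i, (C : ℝ) ^ q * (‖f i‖ ^ q * lam.real (E i) ^ (q / t)) := by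
          refine Finset.sum_le_sum fun i _ => ?_
          refine (Real.rpow_le_rpow (hT0 _) (hb i) hq.le).trans_eq ?_
          have hpos := Real.rpow_nonneg (measureReal_nonneg (μ := lam) (s := E i)) (1 / t)
          rw [Real.mul_rpow C.coe_nonneg (mul_nonneg (Lp_norm_nonneg _) hpos),
            Real.mul_rpow (Lp_norm_nonneg _) hpos, ← Real.rpow_mul measureReal_nonneg,
            one_div_mul_eq_div]
      _ ≤ (C : ℝ) ^ q * (N ^ q * 1) := by
          rw [← Finset.mul_sum]
          refine mul_le_mul_of_nonneg_left (hhold.trans ?_) (by positivity)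
          exact mul_le_mul_of_nonneg_left h1 (by positivity)
      _ = (C * N) ^ q := by rw [mul_one, Real.mul_rpow C.coe_nonneg hN0]
  rw [one_div, Real.rpow_inv_le_iff_of_pos (Finset.sum_nonneg fun i _ =>
    Real.rpow_nonneg (hT0 _) _) (mul_nonneg C.coe_nonneg hN0) hq]
  exact h2

end LocalNorm

/-! ### Dyadic sums and the Lorentz functional -/

theorem lintegral_Ioo_rpow {e a : ℝ} (he : 0 < e) (ha : 0 ≤ a) :
    ∫⁻ τ in Set.Ioo 0 a, ENNReal.ofReal (e * τ ^ (e - 1)) = ENNReal.ofReal (a ^ e) := by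
  have hint : IntervalIntegrable (fun τ : ℝ => e * τ ^ (e - 1)) volume 0 a :=
    (intervalIntegral.intervalIntegrable_rpow' (by linarith)).const_mul e
  rw [restrict_Ioo_eq_restrict_Ioc, ← ofReal_integral_eq_lintegral_ofReal hint.1,
    ← intervalIntegral.integral_of_le ha, intervalIntegral.integral_const_mul,
    integral_rpow (Or.inl (by linarith))]
  · congr 1
    rw [sub_add_cancel, Real.zero_rpow he.ne', sub_zero, mul_div_cancel₀ _ he.ne']
  · filter_upwards [ae_restrict_mem measurableSet_Ioc] with τ hτ
    have := hτ.1
    positivity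

/-- A finite sum of powers `2 ^ (k r)` is controlled by its largest term. -/
theorem sum_zpow_rpow_le {r b : ℝ} (hr : 0 < r) (S : Finset ℤ) (hb : 0 ≤ b)
    (hS : ∀ k ∈ S, (2 : ℝ) ^ k ≤ b) :
    ∑ k ∈ S, ((2 : ℝ) ^ k) ^ r ≤ (1 - 2 ^ (-r))⁻¹ * b ^ r := by
  have hx1 : (2 : ℝ) ^ (-r) < 1 := Real.rpow_lt_one_of_one_lt_of_neg (by norm_num) (by linarith)
  have hx0 : (0 : ℝ) ≤ 2 ^ (-r) := by positivity
  have hgeo := hasSum_geometric_of_lt_one hx0 hx1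
  rcases S.eq_empty_or_nonempty with rfl | hne
  · have : 0 < 1 - (2 : ℝ) ^ (-r) := by linarith
    simp only [Finset.sum_empty]
    positivity
  set K := S.max' hne with hK
  have hle : ∀ k ∈ S, k ≤ K := fun k hk => S.le_max' k hk
  have hterm : ∀ k ∈ S, ((2 : ℝ) ^ k) ^ r = ((2 : ℝ) ^ (-r)) ^ (K - k).toNat * (2 ^ K) ^ r := by
    intro k hk
    have h1 : ((K - k).toNat : ℝ) = (K : ℝ) - k := by
      rw [← Int.cast_sub]
      exact_mod_cast congrArg (Int.cast : ℤ → ℝ) (Int.toNat_of_nonneg (sub_nonneg.2 (hle k hk)))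
    rw [← Real.rpow_intCast, ← Real.rpow_intCast, ← Real.rpow_natCast, h1,
      ← Real.rpow_mul (by norm_num), ← Real.rpow_mul (by norm_num), ← Real.rpow_mul (by norm_num),
      ← Real.rpow_add (by norm_num)]
    congr 1
    ring
  rw [Finset.sum_congr rfl hterm, ← Finset.sum_mul]
  have hsum : ∑ k ∈ S, ((2 : ℝ) ^ (-r)) ^ (K - k).toNat ≤ (1 - 2 ^ (-r))⁻¹ := by
    rw [← Finset.sum_image (f := fun n : ℕ => ((2 : ℝ) ^ (-r)) ^ n) (g := fun k => (K - k).toNat)]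
    · exact sum_le_hasSum _ (fun n _ => pow_nonneg hx0 n) hgeo
    · intro k hk l hl hkl
      have := hle k hk
      have := hle l hl
      simp only at hkl
      omega
  have hpos : 0 ≤ (1 - (2 : ℝ) ^ (-r))⁻¹ := inv_nonneg.2 (by linarith)
  exact mul_le_mul hsum (Real.rpow_le_rpow (by positivity) (hS K (S.max'_mem hne)) hr.le)
    (by positivity) hpos

section Lorentz

variable {Ω : Type*} [MeasurableSpace Ω]

theorem lorentzNorm_rpow {p q : ℝ} (hq : 0 < q) (ν : Measure Ω) (f : Ω → ℝ) :
    lorentzNorm p q ν f ^ q = ∫⁻ t in Set.Ioi (0 : ℝ),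
      ENNReal.ofReal (q / p * t ^ (q / p - 1)) * decreasingRearrangement ν f t ^ q := by
  rw [lorentzNorm, one_div, ENNReal.rpow_inv_rpow hq.ne']

theorem le_decreasingRearrangement {ν : Measure Ω} {f : Ω → ℝ} {a τ : ℝ}
    (h : ENNReal.ofReal τ < ν {x | a < |f x|}) :
    ENNReal.ofReal a ≤ decreasingRearrangement ν f τ := by
  refine le_iInf fun E => le_iInf fun _ => le_iInf fun hE => ?_
  obtain ⟨x, hx, hxE⟩ : ∃ x ∈ {x | a < |f x|}, x ∉ E := by
    by_contra! hcon
    exact absurd (h.trans_le (measure_mono hcon)) (not_lt.2 hE)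
  exact le_iSup₂_of_le x hxE (ENNReal.ofReal_le_ofReal (le_of_lt hx))

/-- E need not be measurable, because its measurable hull has the same measure. -/
theorem decreasingRearrangement_le {ν : Measure Ω} {f : Ω → ℝ} {a τ : ℝ} {E : Set Ω}
    (hE : ν E ≤ ENNReal.ofReal τ) (h : ∀ x ∉ E, |f x| ≤ a) :
    decreasingRearrangement ν f τ ≤ ENNReal.ofReal a := by
  refine iInf_le_of_le (toMeasurable ν E) (iInf_le_of_le (measurableSet_toMeasurable ν E)
    (iInf_le_of_le (by rwa [measure_toMeasurable]) (iSup₂_le fun x hx => ?_)))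
  exact ENNReal.ofReal_le_ofReal (h x fun hxE => hx (subset_toMeasurable ν E hxE))

/-- Dyadic lower bound for the Lorentz functional. -/
theorem sum_dyadic_le_lorentzNorm {p r : ℝ} (hp : 0 < p) (hr : 0 < r) (ν : Measure Ω)
    [IsFiniteMeasure ν] (G : Ω → ℝ) (S : Finset ℤ) :
    ENNReal.ofReal (∑ k ∈ S, ((2 : ℝ) ^ k) ^ r * ν.real {x | (2 : ℝ) ^ k < |G x|} ^ (r / p))
      ≤ ENNReal.ofReal (1 - 2 ^ (-r))⁻¹ * lorentzNorm p r ν G ^ r := by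
  have hx1 : (2 : ℝ) ^ (-r) < 1 := Real.rpow_lt_one_of_one_lt_of_neg (by norm_num) (by linarith)
  have he : 0 < r / p := by positivity
  set m : ℤ → ℝ := fun k => ν.real {x | (2 : ℝ) ^ k < |G x|} with hm
  have hm0 : ∀ k, 0 ≤ m k := fun k => measureReal_nonneg
  have hmeas : Measurable fun τ : ℝ => ENNReal.ofReal (r / p * τ ^ (r / p - 1)) := by fun_prop
  have hterm : ∀ k, ENNReal.ofReal (((2 : ℝ) ^ k) ^ r * m k ^ (r / p))
      = ∫⁻ τ in Set.Ioi (0 : ℝ), ENNReal.ofReal (((2 : ℝ) ^ k) ^ r) *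
          (Set.Ioo 0 (m k)).indicator (fun τ => ENNReal.ofReal (r / p * τ ^ (r / p - 1))) τ := by
    intro k
    rw [lintegral_const_mul _ (hmeas.indicator measurableSet_Ioo),
      lintegral_indicator measurableSet_Ioo, Measure.restrict_restrict measurableSet_Ioo,
      Set.inter_eq_left.2 (Set.Ioo_subset_Ioi_self), lintegral_Ioo_rpow he (hm0 k),
      ENNReal.ofReal_mul (by positivity)]
  rw [ENNReal.ofReal_sum_of_nonneg fun k _ => mul_nonneg (by positivity)
    (Real.rpow_nonneg (hm0 k) _), lorentzNorm_rpow hr]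
  simp only [hterm]
  rw [← lintegral_finsetSum _ fun k _ => (hmeas.indicator measurableSet_Ioo).const_mul _,
    ← lintegral_const_mul' _ _ ENNReal.ofReal_ne_top]
  refine setLIntegral_mono' measurableSet_Ioi fun τ hτ => ?_
  have hτ : 0 < τ := hτ
  classical
  -- Each power of m k was written as an integral over (0, m k). At a fixed τ the surviving levels
  -- satisfy 2 ^ k ≤ G*(τ), so their geometric sum is of the order of G*(τ) ^ r.
  set S' := S.filter fun k => τ < m k with hS'
  have e : ∑ k ∈ S, ENNReal.ofReal (((2 : ℝ) ^ k) ^ r) *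
      (Set.Ioo 0 (m k)).indicator (fun τ => ENNReal.ofReal (r / p * τ ^ (r / p - 1))) τ
      = ENNReal.ofReal (r / p * τ ^ (r / p - 1)) *
        ENNReal.ofReal (∑ k ∈ S', ((2 : ℝ) ^ k) ^ r) := by
    rw [ENNReal.ofReal_sum_of_nonneg fun k _ => by positivity, hS', Finset.sum_filter,
      Finset.mul_sum]
    refine Finset.sum_congr rfl fun k _ => ?_
    by_cases hk : τ < m k
    · simp [hk, hτ, mul_comm]
    · simp [hk]
  rw [e, mul_left_comm]
  refine mul_le_mul_right ?_ _
  have hS'le : ∀ k ∈ S', ENNReal.ofReal ((2 : ℝ) ^ k) ≤ decreasingRearrangement ν G τ := by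
    intro k hk
    refine le_decreasingRearrangement ?_
    have := (Finset.mem_filter.1 hk).2
    rwa [ENNReal.ofReal_lt_iff_lt_toReal hτ.le (measure_ne_top _ _)]
  by_cases htop : decreasingRearrangement ν G τ = ⊤
  · rw [htop, ENNReal.top_rpow_of_pos hr, ENNReal.mul_top]
    · exact le_top
    · have : 0 < (1 - (2 : ℝ) ^ (-r))⁻¹ := inv_pos.2 (by linarith)
      simpa using this
  · rw [← ENNReal.ofReal_toReal htop, ENNReal.ofReal_rpow_of_nonneg ENNReal.toReal_nonneg hr.le,
      ← ENNReal.ofReal_mul (inv_nonneg.2 (by linarith))]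
    refine ENNReal.ofReal_le_ofReal (sum_zpow_rpow_le hr S' ENNReal.toReal_nonneg fun k hk => ?_)
    exact (ENNReal.ofReal_le_iff_le_toReal htop).1 (hS'le k hk)

/-- Upper bound for the Lorentz functional of a function with small support and with a
rearrangement of power type. -/
theorem lorentzNorm_le_of_rearrangement_le {p r σ c m : ℝ} (hr : 0 < r) (hp : 0 < p)
    (hσ : 0 < 1 / p - σ) (hc : 0 ≤ c) (hm : 0 ≤ m) {ν : Measure Ω} {G : Ω → ℝ}
    (hsupp : ∀ τ, m ≤ τ → decreasingRearrangement ν G τ = 0)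
    (h : ∀ τ, 0 < τ → decreasingRearrangement ν G τ ≤ ENNReal.ofReal (c * τ ^ (-σ))) :
    lorentzNorm p r ν G
      ≤ ENNReal.ofReal ((1 / p / (1 / p - σ)) ^ (1 / r) * c * m ^ (1 / p - σ)) := by
  -- The exponent left after multiplying τ^(r/p - 1) by τ^(-σ r) is e - 1, integrable at 0 because e
  -- is positive.
  set e : ℝ := r * (1 / p - σ) with he
  have he0 : 0 < e := by positivity
  have hbound : lorentzNorm p r ν G ^ r ≤ ENNReal.ofReal (r / p / e * c ^ r * m ^ e) := by
    rw [lorentzNorm_rpow hr, ENNReal.ofReal_mul (by positivity), ← lintegral_Ioo_rpow he0 hm,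
      ← lintegral_const_mul' _ _ ENNReal.ofReal_ne_top,
      ← Set.inter_eq_left.2 (Set.Ioo_subset_Ioi_self (a := m) (b := (0 : ℝ))),
      ← Measure.restrict_restrict measurableSet_Ioo, ← lintegral_indicator measurableSet_Ioo]
    refine setLIntegral_mono' measurableSet_Ioi fun τ hτ => ?_
    have hτ : 0 < τ := hτ
    by_cases hτm : τ < m
    · rw [Set.indicator_of_mem (Set.mem_Ioo.2 ⟨hτ, hτm⟩), ← ENNReal.ofReal_mul (by positivity)]
      refine (mul_le_mul_right (ENNReal.rpow_le_rpow (h τ hτ) hr.le) _).trans_eq ?_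
      rw [ENNReal.ofReal_rpow_of_nonneg (by positivity) hr.le, ← ENNReal.ofReal_mul (by positivity),
        Real.mul_rpow hc (by positivity), ← Real.rpow_mul hτ.le]
      congr 1
      have : τ ^ (e - 1) = τ ^ (r / p - 1) * τ ^ (-σ * r) := by
        rw [← Real.rpow_add hτ]; congr 1; rw [he]; ring
      rw [this]
      field_simp
    · rw [hsupp τ (not_lt.1 hτm), ENNReal.zero_rpow_of_pos hr, mul_zero]
      exact bot_le
  have h1 := ENNReal.rpow_le_rpow hbound (one_div_nonneg.2 hr.le)
  rw [one_div, ENNReal.rpow_rpow_inv hr.ne', ENNReal.ofReal_rpow_of_nonneg (by positivity)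
    (by positivity)] at h1
  refine h1.trans_eq ?_
  congr 1
  have h2 : r / p / e = 1 / p / (1 / p - σ) := by rw [he]; field_simp
  rw [Real.mul_rpow (by positivity) (by positivity), Real.mul_rpow (by positivity) (by positivity),
    ← Real.rpow_mul hc, mul_inv_cancel₀ hr.ne', Real.rpow_one, ← Real.rpow_mul hm, h2, one_div r]
  congr 2
  rw [he]
  field_simp

end Lorentz

/-! ### Dyadic decomposition: from sets to Lorentz bounds -/

/-- The dyadic level set `{2 ^ k < |G| ≤ 2 ^ (k + 1)}`. -/
def dyadicLevel {Ω : Type*} (G : Ω → ℝ) (k : ℤ) : Set Ω := {x | (2 : ℝ) ^ k < |G x| ∧ |G x| ≤ 2 ^ (k + 1)}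

theorem pairwise_disjoint_dyadicLevel {Ω : Type*} (G : Ω → ℝ) :
    Pairwise (Function.onFun Disjoint (dyadicLevel G)) := by
  have key : ∀ k l : ℤ, k < l → Disjoint (dyadicLevel G k) (dyadicLevel G l) := by
    intro k l hkl
    refine Set.disjoint_left.2 fun x hk hl => ?_
    have : (2 : ℝ) ^ (k + 1) ≤ 2 ^ l := zpow_le_zpow_right₀ (by norm_num) hkl
    exact absurd (hk.2.trans this) (not_le.2 hl.1)
  intro k l hkl
  rcases lt_or_gt_of_ne hkl with h | h
  · exact key k l h
  · exact (key l k h).symm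

section Factorization

variable {Ω : Type*} [MeasurableSpace Ω] {μ : Measure Ω}
  {Y : Type*} [AddCommGroup Y] [Module ℝ Y] [Norm Y]

theorem measurableSet_dyadicLevel {G : Ω → ℝ} (hG : Measurable G) (k : ℤ) :
    MeasurableSet (dyadicLevel G k) :=
  (measurableSet_lt measurable_const hG.abs).inter (measurableSet_le hG.abs measurable_const)

/-- Summation over dyadic levels: level-wise bounds for `T` give a Lorentz bound. -/
theorem norm_map_le_lorentzNorm {r s p D : ℝ} [RBanachSpace r Y] (hr : 0 < r) (hs : 0 < s)
    (hp : 0 < p) (hD : 0 < D) {T : Lp ℝ (ENNReal.ofReal s) μ →ₗ[ℝ] Y} {M : ℝ}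
    (hM : ∀ f, ‖T f‖ ≤ M * ‖f‖) (ν : Measure Ω) [IsFiniteMeasure ν] {G : Ω → ℝ}
    (hG : Measurable G) {h : Lp ℝ (ENNReal.ofReal s) μ} (hGh : ∀ᵐ x ∂μ, G x = 0 → h x = 0)
    (hb : ∀ k : ℤ, ‖T (indicatorLp h (measurableSet_dyadicLevel hG k))‖
      ≤ D * 2 ^ k * ν.real {x | (2 : ℝ) ^ k < |G x|} ^ (1 / p)) :
    ENNReal.ofReal ‖T h‖
      ≤ ENNReal.ofReal (D * ((1 - 2 ^ (-r))⁻¹) ^ (1 / r)) * lorentzNorm p r ν G := by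
  have hT0 : ∀ f, 0 ≤ ‖T f‖ := fun f => RBanachSpace.norm_nonneg r _
  have hx1 : (2 : ℝ) ^ (-r) < 1 := Real.rpow_lt_one_of_one_lt_of_neg (by norm_num) (by linarith)
  set κ : ℝ := (1 - 2 ^ (-r))⁻¹ with hκ
  have hκ0 : 0 < κ := inv_pos.2 (by linarith)
  by_cases htop : lorentzNorm p r ν G = ⊤
  · rw [htop, ENNReal.mul_top]
    · exact le_top
    · simpa using by positivity
  set L : ℝ := (lorentzNorm p r ν G).toReal with hL
  have hL0 : 0 ≤ L := ENNReal.toReal_nonneg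
  have hLe : lorentzNorm p r ν G = ENNReal.ofReal L := (ENNReal.ofReal_toReal htop).symm
  -- Finite windows of levels exhaust {G ≠ 0}, which carries h; the infinite sum is thus replaced by
  -- a limit of finite ones.
  have hB : ∀ n : ℕ, MeasurableSet (⋃ k ∈ Finset.Ico (-n : ℤ) n, dyadicLevel G k) := fun n =>
    Finset.measurableSet_biUnion _ fun k _ => measurableSet_dyadicLevel hG k
  have hlim := tendsto_norm_sub_indicatorLp hs h hB (by
    filter_upwards [hGh] with x hx hx0
    have hGx : 0 < |G x| := abs_pos.2 fun h0 => hx0 (hx h0)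
    obtain ⟨k, hk⟩ := exists_mem_Ioc_zpow hGx (one_lt_two)
    refine eventually_atTop.2 ⟨k.natAbs + 1, fun n hn => ?_⟩
    refine Set.mem_iUnion₂.2 ⟨k, Finset.mem_Ico.2 ⟨by omega, by omega⟩, hk⟩)
  have hsum : ∀ n : ℕ, indicatorLp h (hB n) =
      ∑ k ∈ Finset.Ico (-n : ℤ) n, indicatorLp h (measurableSet_dyadicLevel hG k) := by
    intro n
    refine Lp.ext ?_
    have h1 : ∀ᵐ x ∂μ, ∀ k, indicatorLp h (measurableSet_dyadicLevel hG k) x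
        = (dyadicLevel G k).indicator h x :=
      ae_all_iff.2 fun k => coeFn_indicatorLp h (measurableSet_dyadicLevel hG k)
    filter_upwards [h1, coeFn_indicatorLp h (hB n), Lp.coeFn_finsetSum (Finset.Ico (-n : ℤ) n)
      fun k => indicatorLp h (measurableSet_dyadicLevel hG k)] with x h1 h2 h3
    rw [h2, h3, Finset.sum_apply, Finset.indicator_biUnion _ _
      fun k _ l _ hkl => pairwise_disjoint_dyadicLevel G hkl]
    exact Finset.sum_congr rfl fun k _ => (h1 k).symm
  have hfin : ‖T h‖ ^ r ≤ D ^ r * (κ * L ^ r) := by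
    refine rpow_norm_map_le_of_tendsto hr T hM hlim fun n => ?_
    rw [hsum, map_sum]
    refine (RBanachSpace.norm_sum_rpow_le hr _ _).trans ?_
    have h2 : ∑ k ∈ Finset.Ico (-n : ℤ) n,
        ((2 : ℝ) ^ k) ^ r * ν.real {x | (2 : ℝ) ^ k < |G x|} ^ (r / p) ≤ κ * L ^ r := by
      have := sum_dyadic_le_lorentzNorm hp hr ν G (Finset.Ico (-n : ℤ) n)
      rw [hLe, ENNReal.ofReal_rpow_of_nonneg hL0 hr.le, ← ENNReal.ofReal_mul hκ0.le] at this
      exact (ENNReal.ofReal_le_ofReal_iff (by positivity)).1 this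
    refine le_trans ?_ (mul_le_mul_of_nonneg_left h2 (by positivity))
    rw [Finset.mul_sum]
    refine Finset.sum_le_sum fun k _ => ?_
    refine (Real.rpow_le_rpow (hT0 _) (hb k) hr.le).trans_eq ?_
    rw [Real.mul_rpow (by positivity) (by positivity), Real.mul_rpow hD.le (by positivity),
      ← Real.rpow_mul measureReal_nonneg, one_div_mul_eq_div, mul_assoc]
  rw [hLe, ← ENNReal.ofReal_mul (by positivity)]
  refine ENNReal.ofReal_le_ofReal ?_
  rw [← Real.rpow_le_rpow_iff (hT0 _) (by positivity) hr]
  refine hfin.trans_eq ?_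
  rw [Real.mul_rpow (by positivity) hL0, Real.mul_rpow hD.le (by positivity),
    ← Real.rpow_mul hκ0.le, one_div_mul_cancel hr.ne', Real.rpow_one, mul_assoc]

/-- Domination on sets implies a Lorentz bound for products with bounded functions. -/
theorem DominatedOnSets.lorentz_mul {r s t : ℝ} [RBanachSpace r Y] (hr : 0 < r)
    (hs : 0 < s) (ht : 0 < t) {T : Lp ℝ (ENNReal.ofReal s) μ →ₗ[ℝ] Y} {M : ℝ}
    (hM : ∀ f, ‖T f‖ ≤ M * ‖f‖) {C : ℝ≥0} {lam : Measure Ω} [IsFiniteMeasure lam]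
    (hC : DominatedOnSets T (1 / t) C lam) (f : Lp ℝ (ENNReal.ofReal s) μ) {g : Ω → ℝ}
    (hg : Measurable g) (hg1 : ∀ x, |g x| ≤ 1) :
    ENNReal.ofReal ‖T ((memLp_mul_of_abs_le_one f hg hg1).toLp (fun x => f x * g x))‖
      ≤ ENNReal.ofReal (2 * (C + 1) * ((1 - 2 ^ (-r))⁻¹) ^ (1 / r)) * ENNReal.ofReal ‖f‖
        * lorentzNorm t r lam g := by
  set h : Lp ℝ (ENNReal.ofReal s) μ :=
    (memLp_mul_of_abs_le_one f hg hg1).toLp (fun x => f x * g x) with hh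
  have hae : h =ᵐ[μ] fun x => f x * g x := MemLp.coeFn_toLp _
  have hx1 : (2 : ℝ) ^ (-r) < 1 := Real.rpow_lt_one_of_one_lt_of_neg (by norm_num) (by linarith)
  have hκ0 : (0 : ℝ) < (1 - 2 ^ (-r))⁻¹ := inv_pos.2 (by linarith)
  have hC0 := C.coe_nonneg
  rcases (Lp_norm_nonneg f).eq_or_lt with h0 | hpos
  · have : ‖T h‖ ≤ 0 := by
      refine (hM h).trans ?_
      have h1 : ‖h‖ ≤ ‖f‖ := by
        refine Lp.norm_le_norm_of_ae_le ?_
        filter_upwards [hae] with x hx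
        rw [hx, norm_mul]
        exact mul_le_of_le_one_right (norm_nonneg _) (hg1 x)
      rw [le_antisymm (h0 ▸ h1) (Lp_norm_nonneg h), mul_zero]
    rw [ENNReal.ofReal_of_nonpos this]
    exact bot_le
  -- On a level |f g| is at most 2 ^ (k + 1) * |f|, whence the factor 2; C + 1 in place of C keeps D
  -- positive.
  · refine (norm_map_le_lorentzNorm (r := r) (D := 2 * (C + 1) * ‖f‖) hr hs ht (by positivity) hM
      lam hg (h := h) ?_ fun k => ?_).trans_eq ?_
    · filter_upwards [hae] with x hx hgx
      rw [hx, hgx, mul_zero]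
    · have hA := measurableSet_dyadicLevel hg k
      set E : Set Ω := {x | (2 : ℝ) ^ k < |g x|} with hE
      have hEm : MeasurableSet E := measurableSet_lt measurable_const hg.abs
      have h1 := hC (indicatorLp h hA) E hEm
      rw [indicatorLp_eq_self hEm] at h1
      · have h2 : ‖indicatorLp h hA‖ ≤ 2 * 2 ^ k * ‖f‖ := by
          rw [← abs_of_pos (show (0 : ℝ) < 2 * 2 ^ k by positivity), ← norm_smul_Lp hs]
          refine Lp.norm_le_norm_of_ae_le ?_
          filter_upwards [hae, coeFn_indicatorLp h hA, Lp.coeFn_smul (2 * 2 ^ k : ℝ) f]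
            with x h3 h4 h5
          rw [h4, h5, Pi.smul_apply, norm_smul, Real.norm_of_nonneg
            (show (0 : ℝ) ≤ 2 * 2 ^ k by positivity)]
          by_cases hx : x ∈ dyadicLevel g k
          · rw [Set.indicator_of_mem hx, h3, norm_mul, mul_comm]
            refine mul_le_mul_of_nonneg_right ?_ (norm_nonneg _)
            have := hx.2
            rwa [zpow_add_one₀ two_ne_zero, mul_comm] at this
          · rw [Set.indicator_of_notMem hx, norm_zero]
            positivity
        calc _ ≤ _ := h1
          _ ≤ (C + 1) * (2 * 2 ^ k * ‖f‖) * lam.real E ^ (1 / t) := by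
            refine mul_le_mul_of_nonneg_right ?_ (by positivity)
            exact mul_le_mul (by linarith) h2 (Lp_norm_nonneg _) (by positivity)
          _ = _ := by ring
      · filter_upwards [coeFn_indicatorLp h hA] with x hx hxE
        rw [hx, Set.indicator_of_notMem fun hxA => hxE hxA.1]
    · rw [← ENNReal.ofReal_mul (by positivity)]
      congr 2
      ring

/-! ### Positive densities and factorization -/

/-- A dominating measure may be replaced by one with a positive density with respect to `μ`. -/
theorem exists_pos_density [SigmaFinite μ] (hμ : μ ≠ 0) (lam : Measure Ω) [IsFiniteMeasure lam] :
    ∃ w : Ω → ℝ, Measurable w ∧ (∀ x, 0 < w x) ∧ Integrable w μ ∧ ∫ x, w x ∂μ = 1 ∧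
      ∃ Z : ℝ, 0 ≤ Z ∧ ∀ E, MeasurableSet E → ∃ E', MeasurableSet E' ∧ E' ⊆ E ∧
        (∀ᵐ x ∂μ, x ∈ E → x ∈ E') ∧
        lam E' ≤ ENNReal.ofReal Z * (μ.withDensity fun x => ENNReal.ofReal (w x)) E := by
  obtain ⟨v, hv0, hvm, hv⟩ := exists_pos_lintegral_lt_of_sigmaFinite μ one_ne_zero
  set w₀ : Ω → ℝ := fun x => (lam.rnDeriv μ x).toReal + v x with hw₀
  have hw₀m : Measurable w₀ :=
    (Measure.measurable_rnDeriv lam μ).ennreal_toReal.add hvm.coe_nnreal_real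
  have hw₀pos : ∀ x, 0 < w₀ x := fun x =>
    add_pos_of_nonneg_of_pos ENNReal.toReal_nonneg (by exact_mod_cast hv0 x)
  have hvint : Integrable (fun x => (v x : ℝ)) μ := by
    refine ⟨hvm.coe_nnreal_real.aestronglyMeasurable, ?_⟩
    rw [hasFiniteIntegral_iff_enorm]
    simpa using hv.trans ENNReal.one_lt_top
  have hw₀int : Integrable w₀ μ := Measure.integrable_toReal_rnDeriv.add hvint
  set Z : ℝ := ∫ x, w₀ x ∂μ with hZ
  have hZpos : 0 < Z := by
    rw [hZ, integral_pos_iff_support_of_nonneg (fun x => (hw₀pos x).le) hw₀int]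
    have : Function.support w₀ = Set.univ := by
      ext x; simp [(hw₀pos x).ne']
    rw [this]
    exact Measure.measure_univ_pos.2 hμ
  refine ⟨fun x => w₀ x / Z, hw₀m.div_const Z, fun x => div_pos (hw₀pos x) hZpos,
    hw₀int.div_const Z, ?_, Z, hZpos.le, fun E hE => ?_⟩
  · rw [integral_div, ← hZ, div_self hZpos.ne']
  -- The singular part of lam lives on a μ-null set, which operators on L_s(μ) do not see; E' is E
  -- with that set removed.
  · obtain ⟨N, hN, hN1, hN2⟩ := Measure.mutuallySingular_singularPart lam μ
    refine ⟨E ∩ N, hE.inter hN, Set.inter_subset_left, ?_, ?_⟩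
    · have : ∀ᵐ x ∂μ, x ∈ N := by
        rw [ae_iff]; exact hN2
      filter_upwards [this] with x hx hxE using ⟨hxE, hx⟩
    · rw [Measure.haveLebesgueDecomposition_add lam μ, Measure.add_apply,
        measure_mono_null Set.inter_subset_right hN1, zero_add]
      refine (measure_mono Set.inter_subset_left).trans ?_
      rw [withDensity_apply _ hE, withDensity_apply _ hE, ← lintegral_const_mul' _ _
        ENNReal.ofReal_ne_top]
      refine lintegral_mono_ae ?_
      filter_upwards [ae_restrict_of_ae (Measure.rnDeriv_lt_top lam μ)] with x hx
      rw [← ENNReal.ofReal_mul hZpos.le, mul_div_cancel₀ _ hZpos.ne',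
        ← ENNReal.ofReal_toReal hx.ne]
      refine ENNReal.ofReal_le_ofReal ?_
      have := (v x).coe_nonneg
      simp only [hw₀]
      linarith

theorem isProbabilityMeasure_withDensity_ofReal {w : Ω → ℝ} (hw : Integrable w μ)
    (hw0 : ∀ x, 0 ≤ w x) (hw1 : ∫ x, w x ∂μ = 1) :
    IsProbabilityMeasure (μ.withDensity fun x => ENNReal.ofReal (w x)) := by
  constructor
  rw [withDensity_apply _ MeasurableSet.univ, Measure.restrict_univ,
    ← ofReal_integral_eq_lintegral_ofReal hw (Eventually.of_forall hw0), hw1, ENNReal.ofReal_one]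

theorem DominatedOnSets.exists_density {r s t : ℝ} [RBanachSpace r Y] [SigmaFinite μ] (hμ : μ ≠ 0)
    (ht : 0 < t) {T : Lp ℝ (ENNReal.ofReal s) μ →ₗ[ℝ] Y} {C : ℝ≥0}
    {lam : Measure Ω} [IsFiniteMeasure lam] (hC : DominatedOnSets T (1 / t) C lam) :
    ∃ w : Ω → ℝ, Measurable w ∧ (∀ x, 0 < w x) ∧ Integrable w μ ∧ ∫ x, w x ∂μ = 1 ∧
      ∃ C' : ℝ≥0,
        DominatedOnSets T (1 / t) C' (μ.withDensity fun x => ENNReal.ofReal (w x)) := by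
  obtain ⟨w, hwm, hw0, hwi, hw1, Z, hZ, h⟩ := exists_pos_density hμ lam
  have := isProbabilityMeasure_withDensity_ofReal hwi (fun x => (hw0 x).le) hw1
  refine ⟨w, hwm, hw0, hwi, hw1, C * ⟨Z ^ (1 / t), Real.rpow_nonneg hZ _⟩, fun f E hE => ?_⟩
  obtain ⟨E', hE', hsub, hae, hle⟩ := h E hE
  have e : indicatorLp f hE = indicatorLp f hE' := by
    refine Lp.ext ?_
    filter_upwards [coeFn_indicatorLp f hE, coeFn_indicatorLp f hE', hae] with x h1 h2 h3
    rw [h1, h2]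
    by_cases hx : x ∈ E
    · simp [hx, h3 hx]
    · rw [Set.indicator_of_notMem hx, Set.indicator_of_notMem fun hx' => hx (hsub hx')]
  rw [e]
  refine (hC f E' hE').trans ?_
  set ν := μ.withDensity fun x => ENNReal.ofReal (w x)
  have h1 : lam.real E' ≤ Z * ν.real E := by
    have := ENNReal.toReal_mono (ENNReal.mul_ne_top ENNReal.ofReal_ne_top (measure_ne_top ν E)) hle
    rwa [ENNReal.toReal_mul, ENNReal.toReal_ofReal hZ] at this
  have h2 : lam.real E' ^ (1 / t) ≤ Z ^ (1 / t) * ν.real E ^ (1 / t) := by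
    rw [← Real.mul_rpow hZ measureReal_nonneg]
    exact Real.rpow_le_rpow measureReal_nonneg h1 (by positivity)
  calc C * ‖f‖ * lam.real E' ^ (1 / t)
      ≤ C * ‖f‖ * (Z ^ (1 / t) * ν.real E ^ (1 / t)) :=
        mul_le_mul_of_nonneg_left h2 (mul_nonneg C.coe_nonneg (Lp_norm_nonneg f))
    _ = (C * Z ^ (1 / t)) * ‖f‖ * ν.real E ^ (1 / t) := by ring

/-- Domination on sets by `w μ` implies factorization through `L_{q,r}(w μ)`. -/
theorem DominatedOnSets.lorentz_factorization {r q s t : ℝ} [RBanachSpace r Y] (hr : 0 < r)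
    (hq : 0 < q) (hs : 0 < s) (ht : 1 / t = 1 / q - 1 / s)
    {T : Lp ℝ (ENNReal.ofReal s) μ →ₗ[ℝ] Y} {M : ℝ} (hM : ∀ f, ‖T f‖ ≤ M * ‖f‖) {C : ℝ≥0}
    {w : Ω → ℝ} (hwm : Measurable w) (hw0 : ∀ x, 0 < w x) {ν : Measure Ω} [IsFiniteMeasure ν]
    (hν : ν = μ.withDensity fun x => ENNReal.ofReal (w x))
    (hC : DominatedOnSets T (1 / t) C ν) (f : Lp ℝ (ENNReal.ofReal s) μ) :
    ENNReal.ofReal ‖T f‖ ≤ ENNReal.ofReal (2 * (C + 1) * ((1 - 2 ^ (-r))⁻¹) ^ (1 / r))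
      * lorentzNorm q r ν (fun x => f x * w x ^ (-1 / s)) := by
  have hC0 := C.coe_nonneg
  set G : Ω → ℝ := fun x => f x * w x ^ (-1 / s) with hGdef
  have hG : Measurable G := (Lp.stronglyMeasurable f).measurable.mul (hwm.pow_const _)
  refine norm_map_le_lorentzNorm (r := r) hr hs hq (by positivity) hM ν hG ?_ fun k => ?_
  · refine Eventually.of_forall fun x hx => ?_
    exact (mul_eq_zero.1 hx).resolve_right (Real.rpow_pos_of_pos (hw0 x) _).ne'
  have hA := measurableSet_dyadicLevel hG k
  set E : Set Ω := {x | (2 : ℝ) ^ k < |G x|} with hE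
  have hEm : MeasurableSet E := measurableSet_lt measurable_const hG.abs
  have h1 := hC (indicatorLp f hA) E hEm
  rw [indicatorLp_eq_self hEm] at h1
  -- On the level |f| ≤ 2 ^ (k + 1) * w ^ (1/s), so the s-th power integrates against μ to a
  -- multiple of ν(E). The exponents 1/s from here and 1/t from domination add up to 1/q.
  · have h2 : ‖indicatorLp f hA‖ ≤ 2 * 2 ^ k * ν.real E ^ (1 / s) := by
      have h3 : ENNReal.ofReal ‖indicatorLp f hA‖ ^ s
          ≤ ENNReal.ofReal ((2 * 2 ^ k) ^ s * ν.real E) := by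
        rw [ofReal_norm_rpow hs, ENNReal.ofReal_mul (by positivity), ofReal_measureReal, hν,
          withDensity_apply _ hEm, ← lintegral_const_mul' _ _ ENNReal.ofReal_ne_top,
          ← lintegral_indicator hEm]
        refine lintegral_mono_ae ?_
        filter_upwards [coeFn_indicatorLp f hA] with x hx
        rw [hx]
        by_cases hxA : x ∈ dyadicLevel G k
        · have hxE : x ∈ E := hxA.1
          rw [Set.indicator_of_mem hxA, Set.indicator_of_mem hxE,
            ENNReal.ofReal_rpow_of_nonneg (abs_nonneg _) hs.le, ← ENNReal.ofReal_mul (by positivity)]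
          refine ENNReal.ofReal_le_ofReal ?_
          have hfx : |f x| = |G x| * w x ^ (1 / s) := by
            rw [hGdef]
            simp only
            rw [abs_mul, abs_of_pos (Real.rpow_pos_of_pos (hw0 x) _), mul_assoc,
              ← Real.rpow_add (hw0 x), neg_div, neg_add_cancel, Real.rpow_zero, mul_one]
          rw [hfx, Real.mul_rpow (abs_nonneg _) (Real.rpow_nonneg (hw0 x).le _),
            ← Real.rpow_mul (hw0 x).le, one_div_mul_cancel hs.ne', Real.rpow_one]
          refine mul_le_mul_of_nonneg_right (Real.rpow_le_rpow (abs_nonneg _) ?_ hs.le) (hw0 x).le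
          have := hxA.2
          rwa [zpow_add_one₀ two_ne_zero, mul_comm] at this
        · rw [Set.indicator_of_notMem hxA, abs_zero, ENNReal.ofReal_zero,
            ENNReal.zero_rpow_of_pos hs]
          exact bot_le
      rw [ENNReal.ofReal_rpow_of_nonneg (Lp_norm_nonneg _) hs.le,
        ENNReal.ofReal_le_ofReal_iff (by positivity)] at h3
      rw [← Real.rpow_le_rpow_iff (Lp_norm_nonneg _) (by positivity) hs]
      refine h3.trans_eq ?_
      rw [Real.mul_rpow (x := 2 * 2 ^ k) (by positivity) (by positivity),
        ← Real.rpow_mul measureReal_nonneg, one_div_mul_cancel hs.ne', Real.rpow_one]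
    have h4 : ν.real E ^ (1 / s) * ν.real E ^ (1 / t) = ν.real E ^ (1 / q) := by
      rw [← Real.rpow_add' measureReal_nonneg] <;> rw [ht, add_sub_cancel]
      positivity
    calc _ ≤ _ := h1
      _ ≤ (C + 1) * (2 * 2 ^ k * ν.real E ^ (1 / s)) * ν.real E ^ (1 / t) := by
        refine mul_le_mul_of_nonneg_right ?_ (by positivity)
        exact mul_le_mul (by linarith) h2 (Lp_norm_nonneg _) (by positivity)
      _ = 2 * (C + 1) * 2 ^ k * (ν.real E ^ (1 / s) * ν.real E ^ (1 / t)) := by ring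
      _ = _ := by rw [h4]
  · filter_upwards [coeFn_indicatorLp f hA] with x hx hxE
    rw [hx, Set.indicator_of_notMem fun hxA => hxE hxA.1]

/-! ### From Lorentz bounds back to sets -/

theorem lorentzNorm_indicator_le {t r : ℝ} (ht : 0 < t) (hr : 0 < r) (lam : Measure Ω)
    [IsFiniteMeasure lam] (E : Set Ω) :
    lorentzNorm t r lam (E.indicator 1) ≤ ENNReal.ofReal (lam.real E ^ (1 / t)) := by
  refine (lorentzNorm_le_of_rearrangement_le (σ := 0) (c := 1) (m := lam.real E) hr ht
    (by simpa using ht) zero_le_one measureReal_nonneg (fun τ hτ => ?_) fun τ hτ => ?_).trans_eq ?_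
  · have := decreasingRearrangement_le (ν := lam) (f := E.indicator 1) (a := 0) (τ := τ) (E := E)
      (by rw [← ofReal_measureReal]; exact ENNReal.ofReal_le_ofReal hτ) fun x hx => by simp [hx]
    simpa using this
  · refine decreasingRearrangement_le (E := ∅) (by simp) fun x _ => ?_
    by_cases hx : x ∈ E <;> simp [hx]
  · simp [ht.ne']

/-- The Lorentz functional of `F w ^ (-1 / s)`, for `F ∈ L_s` supported in `E`. -/
theorem lorentzNorm_mul_rpow_le {r q s t : ℝ} (hr : 0 < r) (hq : 0 < q) (hs : 0 < s) (ht0 : 0 < t)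
    (ht : 1 / t = 1 / q - 1 / s) {w : Ω → ℝ} (hw : Integrable w μ) (hw0 : ∀ x, 0 ≤ w x)
    {ν : Measure Ω} [IsFiniteMeasure ν] (hν : ν = μ.withDensity fun x => ENNReal.ofReal (w x))
    {F : Lp ℝ (ENNReal.ofReal s) μ} {E : Set Ω} (hFE : ∀ᵐ x ∂μ, x ∉ E → F x = 0) :
    lorentzNorm q r ν (fun x => F x * w x ^ (-1 / s))
      ≤ ENNReal.ofReal ((t / q) ^ (1 / r) * ‖F‖ * ν.real E ^ (1 / t)) := by
  have hac : ν ≪ μ := hν ▸ withDensity_absolutelyContinuous _ _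
  set G : Ω → ℝ := fun x => F x * w x ^ (-1 / s) with hG
  have hGm : AEMeasurable G μ :=
    (Lp.stronglyMeasurable F).measurable.aemeasurable.mul (hw.aemeasurable.pow_const _)
  -- Only an inequality: the part of F on {w = 0} is invisible to ν.
  have hGint : ∫⁻ x, ENNReal.ofReal |G x| ^ s ∂ν ≤ ENNReal.ofReal ‖F‖ ^ s := by
    have hm : AEMeasurable (fun x => ENNReal.ofReal |G x| ^ s) μ :=
      (measurable_norm.comp_aemeasurable hGm).ennreal_ofReal.pow_const s
    rw [ofReal_norm_rpow hs, hν,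
      lintegral_withDensity_eq_lintegral_mul₀ hw.aemeasurable.ennreal_ofReal hm]
    refine lintegral_mono fun x => ?_
    rw [Pi.mul_apply, ENNReal.ofReal_rpow_of_nonneg (abs_nonneg _) hs.le,
      ENNReal.ofReal_rpow_of_nonneg (abs_nonneg _) hs.le, ← ENNReal.ofReal_mul (hw0 x)]
    refine ENNReal.ofReal_le_ofReal ?_
    rcases (hw0 x).eq_or_lt with h0 | hpos
    · rw [← h0, zero_mul]; positivity
    · rw [hG]
      simp only
      rw [abs_mul, abs_of_pos (Real.rpow_pos_of_pos hpos _), Real.mul_rpow (abs_nonneg _)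
        (Real.rpow_nonneg hpos.le _), ← Real.rpow_mul hpos.le, div_mul_cancel₀ _ hs.ne',
        Real.rpow_neg_one, mul_left_comm, mul_inv_cancel₀ hpos.ne', mul_one]
  have hσ : 0 < 1 / q - 1 / s := by rw [← ht]; positivity
  -- Chebyshev gives G*(τ) ≤ ‖F‖ τ^(-1/s), and the support gives G*(τ) = 0 for τ ≥ ν(E). Since 1/q -
  -- 1/s = 1/t, the resulting constant is (t/q)^(1/r).
  refine (lorentzNorm_le_of_rearrangement_le (σ := 1 / s) (c := ‖F‖) (m := ν.real E) hr hq
    hσ (Lp_norm_nonneg F) measureReal_nonneg (fun τ hτ => ?_) fun τ hτ => ?_).trans_eq ?_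
  · have hnull : ν {x | ¬ (x ∉ E → F x = 0)} = 0 := hac (ae_iff.1 hFE)
    have := decreasingRearrangement_le (ν := ν) (f := G) (a := 0) (τ := τ)
      (E := E ∪ {x | ¬ (x ∉ E → F x = 0)})
      ((measure_union_le _ _).trans (by
        rw [hnull, add_zero, ← ofReal_measureReal]; exact ENNReal.ofReal_le_ofReal hτ))
      fun x hx => by
        simp only [Set.mem_union, not_or] at hx
        have h0 : F x = 0 := not_not.1 hx.2 hx.1
        simp [hG, h0]
    simpa using this
  · rcases (Lp_norm_nonneg F).eq_or_lt with h0 | hpos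
    · have hF : F = 0 := (Lp.norm_eq_zero_iff (by simpa using hs)).1 h0.symm
      have hnull : ν {x | F x ≠ 0} = 0 := by
        refine hac ?_
        rw [hF]
        exact ae_iff.1 (Lp.coeFn_zero ℝ (ENNReal.ofReal s) μ)
      refine decreasingRearrangement_le (E := {x | F x ≠ 0}) (by simp [hnull]) fun x hx => ?_
      have : F x = 0 := by simpa using hx
      simp [hG, this, ← h0]
    · set a : ℝ := ‖F‖ * τ ^ (-(1 / s)) with ha
      have ha0 : 0 < a := by positivity
      refine decreasingRearrangement_le (E := {x | ENNReal.ofReal a ^ s ≤ ENNReal.ofReal |G x| ^ s})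
        ?_ fun x hx => ?_
      · have hm : AEMeasurable (fun x => ENNReal.ofReal |G x| ^ s) ν :=
          (measurable_norm.comp_aemeasurable (hGm.mono_ac hac)).ennreal_ofReal.pow_const s
        have h1 := (mul_meas_ge_le_lintegral₀ hm (ENNReal.ofReal a ^ s)).trans hGint
        have h2 : ENNReal.ofReal ‖F‖ ^ s = ENNReal.ofReal a ^ s * ENNReal.ofReal τ := by
          rw [ENNReal.ofReal_rpow_of_nonneg ha0.le hs.le, ENNReal.ofReal_rpow_of_nonneg hpos.le hs.le,
            ← ENNReal.ofReal_mul (by positivity)]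
          congr 1
          rw [ha, Real.mul_rpow hpos.le (by positivity), ← Real.rpow_mul hτ.le, neg_mul,
            one_div_mul_cancel hs.ne', Real.rpow_neg_one, mul_assoc, inv_mul_cancel₀ hτ.ne', mul_one]
        rw [h2] at h1
        refine (ENNReal.mul_le_mul_iff_right ?_ ?_).1 h1
        · exact (ENNReal.rpow_pos (by simpa using ha0) ENNReal.ofReal_ne_top).ne'
        · exact ENNReal.rpow_ne_top_of_nonneg hs.le ENNReal.ofReal_ne_top
      · have hx : ¬ ENNReal.ofReal a ^ s ≤ ENNReal.ofReal |G x| ^ s := hx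
        rw [ENNReal.rpow_le_rpow_iff hs, ENNReal.ofReal_le_ofReal_iff (abs_nonneg _)] at hx
        exact (not_le.1 hx).le
  · rw [← ht]
    congr 4
    field_simp

end Factorization

/-! ### The equivalences, with (ii) as the hub -/

theorem theorem4p2 {Ω : Type*} [MeasurableSpace Ω] (μ : Measure Ω) [SigmaFinite μ] (hμ : μ ≠ 0)
    (r q s t : ℝ) (hr : 0 < r) (hrq : r ≤ q) (hqs : q < s) (ht : 1 / t = 1 / q - 1 / s)
    {Y : Type*} [AddCommGroup Y] [Module ℝ Y] [Norm Y] [RBanachSpace r Y]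
    (T : Lp ℝ (ENNReal.ofReal s) μ →ₗ[ℝ] Y)
    (hT : ∃ M : ℝ, ∀ f : Lp ℝ (ENNReal.ofReal s) μ, ‖T f‖ ≤ M * ‖f‖) :
    List.TFAE
      [ -- (i)
        ∃ C : ℝ≥0, ∀ (n : ℕ) (f : Fin n → Lp ℝ (ENNReal.ofReal s) μ),
          (∀ i j, i ≠ j → ∀ᵐ x ∂μ, f i x = 0 ∨ f j x = 0) →
          (∑ i, ‖T (f i)‖ ^ q) ^ (1 / q) ≤ C * ‖∑ i, |f i|‖,
        -- (ii)
        ∃ (C : ℝ≥0) (lam : Measure Ω), IsProbabilityMeasure lam ∧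
          ∀ (f : Lp ℝ (ENNReal.ofReal s) μ) (E : Set Ω) (hE : MeasurableSet E),
            ‖T (((Lp.memLp f).indicator hE).toLp (E.indicator f))‖
              ≤ C * ‖f‖ * lam.real E ^ (1 / q - 1 / s),
        -- (iii)
        ∃ (C : ℝ≥0) (lam : Measure Ω), IsProbabilityMeasure lam ∧
          ∀ (f : Lp ℝ (ENNReal.ofReal s) μ) (g : Ω → ℝ) (hg : Measurable g)
            (hg1 : ∀ x, |g x| ≤ 1),
            ENNReal.ofReal ‖T ((memLp_mul_of_abs_le_one f hg hg1).toLp (fun x => f x * g x))‖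
              ≤ C * ENNReal.ofReal ‖f‖ * lorentzNorm t r lam g,
        -- (iv)
        ∃ (C : ℝ≥0) (w : Ω → ℝ), Integrable w μ ∧ (∀ x, 0 ≤ w x) ∧ ∫ x, w x ∂μ = 1 ∧
          ∀ f : Lp ℝ (ENNReal.ofReal s) μ,
            ENNReal.ofReal ‖T f‖
              ≤ C * lorentzNorm q r (μ.withDensity fun x => ENNReal.ofReal (w x))
                  (fun x => f x * w x ^ (-1 / s))] := by
  obtain ⟨M, hM⟩ := hT
  have hq : 0 < q := hr.trans_le hrq
  have hs : 0 < s := hq.trans hqs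
  have ht' : 0 < 1 / t := by
    rw [ht, sub_pos]
    exact one_div_lt_one_div_of_lt hq hqs
  have ht0 : 0 < t := one_div_pos.1 ht'
  have hqt : q ≤ t := by
    rw [← one_div_le_one_div ht0 hq, ht]
    linarith [one_div_pos.2 hs]
  have hne : Nonempty Ω := by
    by_contra h
    rw [not_nonempty_iff] at h
    exact hμ (Measure.eq_zero_of_isEmpty μ)
  tfae_have 1 → 2 := by
    rintro ⟨C, hC⟩
    obtain ⟨C', lam, hlam, h⟩ := exists_dominatedOnSets (r := r) hr (hrq.trans hqt) hq hs ht0 ht hM hC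
    exact ⟨C', lam, hlam, ht ▸ h⟩
  tfae_have 2 → 1 := by
    rintro ⟨C, lam, hlam, h⟩
    rw [← ht] at h
    exact ⟨C, fun n f hf => sum_norm_map_le_of_dominatedOnSets (r := r) hq hqs ht0 ht h f hf⟩
  tfae_have 2 → 3 := by
    rintro ⟨C, lam, hlam, h⟩
    rw [← ht] at h
    exact ⟨_, lam, hlam, fun f g hg hg1 =>
      DominatedOnSets.lorentz_mul (r := r) hr hs ht0 hM h f hg hg1⟩
  tfae_have 3 → 2 := by
    rintro ⟨C, lam, hlam, h⟩
    refine ⟨C, lam, hlam, fun f E hE => ?_⟩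
    have h1 := h f (E.indicator 1) (measurable_one.indicator hE) fun x => by
      by_cases hx : x ∈ E <;> simp [hx]
    have e : (memLp_mul_of_abs_le_one f (measurable_one.indicator hE) (fun x => by
        by_cases hx : x ∈ E <;> simp [hx])).toLp (fun x => f x * E.indicator 1 x)
        = ((Lp.memLp f).indicator hE).toLp (E.indicator f) := by
      refine MemLp.toLp_congr _ _ (Eventually.of_forall fun x => ?_)
      by_cases hx : x ∈ E <;> simp [hx]
    rw [e] at h1
    have h2 := h1.trans (mul_le_mul_right (lorentzNorm_indicator_le ht0 hr lam E) _)
    rw [← ENNReal.ofReal_coe_nnreal, ← ENNReal.ofReal_mul C.coe_nonneg,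
      ← ENNReal.ofReal_mul (mul_nonneg C.coe_nonneg (Lp_norm_nonneg f)),
      ENNReal.ofReal_le_ofReal_iff (mul_nonneg (mul_nonneg C.coe_nonneg (Lp_norm_nonneg f))
        (by positivity)), ht] at h2
    exact h2
  tfae_have 2 → 4 := by
    rintro ⟨C, lam, hlam, h⟩
    rw [← ht] at h
    obtain ⟨w, hwm, hw0, hwi, hw1, C', h'⟩ := DominatedOnSets.exists_density (r := r) hμ ht0 h
    have := isProbabilityMeasure_withDensity_ofReal hwi (fun x => (hw0 x).le) hw1
    exact ⟨_, w, hwi, fun x => (hw0 x).le, hw1, fun f =>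
      h'.lorentz_factorization (r := r) hr hq hs ht hM hwm hw0 rfl f⟩
  tfae_have 4 → 2 := by
    rintro ⟨C, w, hwi, hw0, hw1, h⟩
    have := isProbabilityMeasure_withDensity_ofReal hwi hw0 hw1
    refine ⟨C * ⟨(t / q) ^ (1 / r), by positivity⟩, _, this, fun f E hE => ?_⟩
    set ν := μ.withDensity fun x => ENNReal.ofReal (w x) with hν
    change ‖T (indicatorLp f hE)‖ ≤ _
    have hFE : ∀ᵐ x ∂μ, x ∉ E → indicatorLp f hE x = 0 := by
      filter_upwards [coeFn_indicatorLp f hE] with x hx hxE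
      rw [hx, Set.indicator_of_notMem hxE]
    have h1 := (h (indicatorLp f hE)).trans (mul_le_mul_right
      (lorentzNorm_mul_rpow_le hr hq hs ht0 ht hwi hw0 hν hFE) _)
    have hnn := Lp_norm_nonneg (indicatorLp f hE)
    rw [← ENNReal.ofReal_coe_nnreal, ← ENNReal.ofReal_mul C.coe_nonneg,
      ENNReal.ofReal_le_ofReal_iff (by positivity)] at h1
    rw [← ht]
    calc ‖T (indicatorLp f hE)‖
        ≤ C * ((t / q) ^ (1 / r) * ‖indicatorLp f hE‖ * ν.real E ^ (1 / t)) := h1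
      _ ≤ C * ((t / q) ^ (1 / r) * ‖f‖ * ν.real E ^ (1 / t)) := by
          have := norm_indicatorLp_le f hE
          gcongr
      _ = (C * (t / q) ^ (1 / r)) * ‖f‖ * ν.real E ^ (1 / t) := by ring
  tfae_finish
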